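/- **Conventions.** Let $\mathbf k$ be an ordered exponential field: an ordered field with an isomorphism $\exp$ from the ordered group $(\mathbf k,+)$ onto $(\mathbf k^{>0},\cdot)$; let $\log=\exp^{-1}$. For a multiplicative ordered abelian group $G$, $\mathbf k((G))$ is the ordered field of generalized power series with coefficients in $\mathbf k$ and anti-well-ordered support in $G$; for $S\subseteq G$, $\mathbf k((S))$ is the set of series with support in $S$; and for a subgroup $U$ of a group $G'$ of monomials, $G'^{>U}=\{g\in G' : g>u \text{ for all } u\in U\}$. **EL-series fields.** A prelogarithmic section of $\mathbf k((G))$ is an embedding of ordered groups $l:(G,\cdot)\to(\mathbf k((G^{>1})),+)$. The associated prelogarithm on $\mathbf k((G))^{>0}$ is $L(g\,a\,(1+\varepsilon))=l(g)+\log a+\sum_{i\ge1}(-1)^{i-1}\varepsilon^i/i$ ($g\in G$, $a\in\mathbf k^{>0}$, $\varepsilon\in\mathbf k((G^{<1}))$). The exponential extension is $\mathbf k((G^\#))$, where $G^\#=e[\mathbf k((G^{>1}))]$ is a multiplicative copy of the ordered group $\mathbf k((G^{>1}))$ into which $G$ is embedded by $g\mapsto e(l(g))$, with the section $l^\#(e(\alpha))=\alpha$.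 Iterating, one gets $\mathbf k((G^{\# n}))$ with prelogarithms $L^{\# n}$; put $\mathbf k((G))^{EL}=\bigcup_n\mathbf k((G^{\# n}))$, $\mathrm{Log}=\bigcup_n L^{\# n}$, $\mathrm{Exp}=\mathrm{Log}^{-1}$. A morphism $(\mathbf k((G_1)),l_1)\to(\mathbf k((G_2)),l_2)$ is an embedding $\psi:G_1\to G_2$ of ordered groups whose natural extension to series satisfies $\psi\circ l_1=l_2\circ\psi$. It induces $\psi^\#:e(\alpha)\mapsto e(\psi(\alpha))$, and by iteration $\psi^{EL}:\mathbf k((G_1))^{EL}\to\mathbf k((G_2))^{EL}$. **The construction $LE(H,\psi)$.** For a morphism $\psi$ of $(\mathbf k((G)),l)$ into itself and a subgroup $H\le G$ put $G_m^{-1}=\{1\}$, $G_m^0=\psi^{(m)}(H)$ ($m$-fold iterate), $G_m^{n+1}=G_m^n\cdot\mathrm{Exp}\,\mathbf k\big(((G_m^n)^{>G_m^{n-1}})\big)\subseteq G^{\#(n+1)}$, $L_m=\bigcup_n\mathbf k((G_m^n))$ and $LE(H,\psi)=\bigcup_m L_m\subseteq\mathbf k((G))^{EL}$. **The LE-series field.**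 Let $G_{-1}=1$, let $G_0=x^{\mathbf k}$ be a multiplicative copy of the ordered group $\mathbf k$, and let $G_{n+1}=G_n\times e[A_n]$, ordered anti-lexicographically (the factor $e[A_n]$ dominates), where $e[A_n]$ is a multiplicative copy of $A_n=\mathbf k((G_n^{>G_{n-1}}))$. Put $K_n=\mathbf k((G_n))$ and $\mathbf k((x^{-1}))^{E}=\bigcup_nK_n$, with exponential $\exp(\alpha+\beta+\varepsilon)=e(\alpha)\,\exp(\beta)\,\sum_i\varepsilon^i/i!$ for $\alpha\in A_n$, $\beta\in\mathbf k((G_{n-1}))$ and $\varepsilon\in\mathbf k((G_n))$ with all monomials smaller than $G_{n-1}$. The substitution $\Phi$ of $\exp(x)$ for $x$ on $\mathbf k((x^{-1}))^{E}$ is the map respecting infinite sums with $x^r\mapsto e(rx)$ on $G_0$ and $g\,e(\alpha)\mapsto\Phi(g)\,e(\Phi(\alpha))$ on $G_{n+1}$. The field $\mathbf k((x^{-1}))^{LE}$ of logarithmic-exponential series is the union of copies $L_0\subseteq L_1\subseteq\cdots$ of $\mathbf k((x^{-1}))^{E}$, where $L_m\to L_{m+1}$ is given by $\Phi$ (the element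 $f$ of the copy $L_m$ stands for $f(\log_m x)$); its exponential, and composition with $\exp(x)$, are those given by $\exp$ and by $\Phi$ on each $L_m$. The field of (grid-based) transseries of Écalle is here the smallest subfield $\mathbb T$ of $\mathbf k((x^{-1}))^{LE}$ that contains $\mathbf k$ and $x$, is closed under exponentials and under logarithms of positive elements, and contains every series, in some $K_n$ within some $L_m$, whose support lies in $g_0g_1^{\mathbb N}\cdots g_p^{\mathbb N}$ for monomials $g_0,\dots,g_p$ in the subfield with $g_1,\dots,g_p<1$. **Theorem.** Let $G$ be the group of logarithmic words $x^{r_0}(\log x)^{r_1}\cdots(\log_n x)^{r_n}$ ($n\ge 0$, $r_i\in\mathbf k$), ordered lexicographically, with the prelogarithmic section $l(x^{r_0}\cdots(\log_n x)^{r_n})=\sum_i r_i\log_{i+1}x$ and the morphism $\psi(x^{r_0}\cdots(\log_nx)^{r_n})=(\log x)^{r_0}\cdots(\log_{n+1}x)^{r_n}$, and let $H=\{x^r: r\in\mathbf k\}$. 1. Every EL-series field $\mathbf k((G'))^{EL}$ and the field $\mathbf k((x^{-1}))^{LE}$ are ordered exponential fields. For the logarithmic words, $\psi^{EL}$ is bijective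 and $L_0\subseteq L_1\subseteq\cdots$ in $\mathbf k((G))^{EL}$. 2. There is an embedding $\theta:\mathbf k((x^{-1}))^{LE}\to\mathbf k((G))^{EL}$ of ordered exponential fields over $\mathbf k$ with image $LE(H,\psi)$, with $\theta(x)=x$ and $\theta(L_m)=L_m$ for all $m$. For all $m,n$, on the subfield $K_n=\mathbf k((G_n))$ of the copy $L_m$ it is induced by an isomorphism of ordered groups from $G_n$ onto $G_m^n$. Under $\theta$, composition with $\exp(x)$ on $\mathbf k((x^{-1}))^{LE}$ becomes $(\psi^{EL})^{-1}$. 3. Consequently $\mathbf k((x^{-1}))^{LE}$ embeds, as an ordered exponential field over $\mathbf k$, into every EL-series field over a prelogarithmic series field containing the logarithmic words: for every morphism $\iota$ from $(\mathbf k((G)),l)$ to $(\mathbf k((G')),l')$ there is such an embedding into $\mathbf k((G'))^{EL}$ with $x\mapsto\iota(x)$. In particular, for every ordered set $I$, every order embedding $\sigma:I\to I$ with $\sigma(i)<i$ for all $i$, and every $i\in I$, there is such an embedding into the EL-series field over the Hahn group $I^{\mathbf k}$ of products $\prod_{j\in I}x_j^{g_j}$ ($g_j\in\mathbf k$, anti-well-ordered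 support, ordered anti-lexicographically) with the section $l_\sigma(\prod x_j^{g_j})=\sum g_jx_{\sigma(j)}$, with $x\mapsto x_i$. The field $\mathbb T$ of transseries is an ordered exponential subfield of $\mathbf k((x^{-1}))^{LE}$, and it embeds as an ordered exponential field into all these EL-series fields (for nonempty $I$). -/

import Mathlib

universe u v
set_option linter.unusedSectionVars false

noncomputable section

namespace LESeries

/-- `E` makes the ordered field `K` an ordered exponential field: an isomorphism from the ordered
group `(K, +)` onto the ordered group `(K^{>0}, ·)`. -/
structure IsOrderedExp {K : Type*} [Field K] [LinearOrder K] (E : K → K) : Prop where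
  strictMono : StrictMono E
  map_add : ∀ a b, E (a + b) = E a * E b
  range_eq : Set.range E = Set.Ioi 0

/-! ### Unions of chains of ordered fields -/

section Chain

variable {X : ℕ → Type u} [∀ n, Field (X n)] [∀ n, LinearOrder (X n)]

/-- The composite map `X m → X n` of a chain of ordered fields. -/
def transition (f : ∀ n, X n →+*o X (n + 1)) (m n : ℕ) (h : m ≤ n) : X m →+* X n :=
  Nat.leRecOn h (fun {i} g => (f i : X i →+* X (i + 1)).comp g) (RingHom.id (X m))

variable (f : ∀ n, X n →+*o X (n + 1))

lemma transition_self (m : ℕ) : transition f m m le_rfl = RingHom.id (X m) :=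
  Nat.leRecOn_self _

lemma transition_succ (m n : ℕ) (h : m ≤ n) :
    transition f m (n + 1) (h.trans n.le_succ)
      = (f n : X n →+* X (n + 1)).comp (transition f m n h) :=
  Nat.leRecOn_succ h _

lemma transition_trans (l m n : ℕ) (h : l ≤ m) (h' : m ≤ n) (x : X l) :
    transition f m n h' (transition f l m h x) = transition f l n (h.trans h') x := by
  induction n, h' using Nat.le_induction with
  | base => simp [transition_self]
  | succ n hn ih =>
    rw [transition_succ f m n hn, transition_succ f l n (h.trans hn)]
    simp [ih]

lemma transition_le_iff (m n : ℕ) (h : m ≤ n) (x y : X m) :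
    transition f m n h x ≤ transition f m n h y ↔ x ≤ y := by
  have hf : ∀ n, StrictMono (f n) := fun n =>
    (f n).monotone'.strictMono_of_injective (f n : X n →+* X (n + 1)).injective
  induction n, h using Nat.le_induction with
  | base => simp [transition_self]
  | succ n hn ih =>
    rw [transition_succ f m n hn]
    simpa using ((hf n).le_iff_le.trans ih)

instance : DirectedSystem X (fun i j h => transition f i j h) where
  map_self i x := by simp [transition_self]
  map_map k j i hij hjk x := transition_trans f i j k hij hjk x

/-- The union of a chain `X 0 → X 1 → X 2 → ⋯` of ordered fields. -/
def ChainUnion : Type u := DirectLimit X (transition f)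

namespace ChainUnion

/-- The element of the union given by an element of the `n`-th member of the chain. -/
def mk (n : ℕ) (x : X n) : ChainUnion f := (⟦⟨n, x⟩⟧ : DirectLimit X (transition f))

instance : Field (ChainUnion f) := inferInstanceAs (Field (DirectLimit X (transition f)))

instance : LE (ChainUnion f) where
  le := DirectLimit.lift₂ (transition f) (transition f) (fun _ x y => x ≤ y)
    (fun i j h x y => propext (transition_le_iff f i j h x y).symm)

lemma mk_le_mk (n : ℕ) (x y : X n) : mk f n x ≤ mk f n y ↔ x ≤ y :=
  iff_of_eq (DirectLimit.lift₂_def (transition f) (transition f) (fun _ x y => x ≤ y)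
    (fun i j h x y => propext (transition_le_iff f i j h x y).symm) n x y)

lemma mk_add (n : ℕ) (x y : X n) : mk f n (x + y) = mk f n x + mk f n y :=
  (DirectLimit.add_def n x y).symm

lemma mk_mul (n : ℕ) (x y : X n) : mk f n (x * y) = mk f n x * mk f n y :=
  (DirectLimit.mul_def n x y).symm

lemma exists_mk (a : ChainUnion f) : ∃ n x, mk f n x = a :=
  let ⟨n, x, h⟩ := DirectLimit.exists_eq_mk (transition f) a
  ⟨n, x, h.symm⟩

lemma exists_mk₂ (a b : ChainUnion f) : ∃ n x y, mk f n x = a ∧ mk f n y = b :=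
  let ⟨n, x, y, h, h'⟩ := DirectLimit.exists_eq_mk₂ (transition f) a b
  ⟨n, x, y, h.symm, h'.symm⟩

lemma exists_mk₃ (a b c : ChainUnion f) :
    ∃ n x y z, mk f n x = a ∧ mk f n y = b ∧ mk f n z = c :=
  let ⟨n, x, y, z, h, h', h''⟩ := DirectLimit.exists_eq_mk₃ (transition f) a b c
  ⟨n, x, y, z, h.symm, h'.symm, h''.symm⟩

instance : LinearOrder (ChainUnion f) where
  le_refl a := by
    obtain ⟨n, x, rfl⟩ := exists_mk f a
    exact (mk_le_mk f n x x).2 le_rfl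
  le_trans a b c := by
    obtain ⟨n, x, y, z, rfl, rfl, rfl⟩ := exists_mk₃ f a b c
    simpa only [mk_le_mk] using le_trans
  le_antisymm a b := by
    obtain ⟨n, x, y, rfl, rfl⟩ := exists_mk₂ f a b
    simp only [mk_le_mk]
    exact fun h h' => congrArg _ (h.antisymm h')
  le_total a b := by
    obtain ⟨n, x, y, rfl, rfl⟩ := exists_mk₂ f a b
    simpa only [mk_le_mk] using le_total x y
  toDecidableLE := Classical.decRel _

/-- The inclusion of the `n`-th member into the union of the chain. -/
def of (n : ℕ) : X n →+*o ChainUnion f where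
  toFun := mk f n
  map_one' := (DirectLimit.one_def n).symm
  map_zero' := (DirectLimit.zero_def n).symm
  map_mul' := mk_mul f n
  map_add' := mk_add f n
  monotone' x y h := (mk_le_mk f n x y).2 h

lemma exists_of (a : ChainUnion f) : ∃ n x, of f n x = a := exists_mk f a

lemma of_succ (n : ℕ) (x : X n) : of f (n + 1) (f n x) = of f n x := by
  have h := transition_succ f n n le_rfl
  rw [transition_self] at h
  have h' : transition f (n + 1) (n + 1) le_rfl (f n x) = transition f n (n + 1) n.le_succ x := by
    rw [h, transition_self]
    rfl
  exact Quotient.sound ⟨n + 1, le_rfl, n.le_succ, h'⟩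

section lift

variable {f} {K : Type u} [Field K] [LinearOrder K]

/-- The map out of the union given by compatible maps out of the members of the chain. -/
def lift (g : ∀ n, X n →+*o K) (hg : ∀ n x, g (n + 1) (f n x) = g n x) :
    ChainUnion f →+*o K :=
  have hg' : ∀ i j h x, g i x = g j (transition f i j h x) := by
    intro i j h x
    induction j, h using Nat.le_induction with
    | base => simp [transition_self]
    | succ n hn ih =>
      rw [transition_succ f i n hn, RingHom.comp_apply]
      exact ih.trans (hg n _).symm
  have hl : ∀ n x, DirectLimit.lift (transition f) (fun n x => g n x) hg' (mk f n x) = g n x :=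
    fun n x => rfl
  { toFun := DirectLimit.lift (transition f) (fun n x => g n x) hg'
    map_one' := by
      rw [← map_one (of f 0)]
      exact (hl 0 1).trans (map_one _)
    map_zero' := by
      rw [← map_zero (of f 0)]
      exact (hl 0 0).trans (map_zero _)
    map_mul' := by
      intro a b
      obtain ⟨n, x, y, rfl, rfl⟩ := exists_mk₂ f a b
      rw [← mk_mul, hl, hl, hl, map_mul]
    map_add' := by
      intro a b
      obtain ⟨n, x, y, rfl, rfl⟩ := exists_mk₂ f a b
      rw [← mk_add, hl, hl, hl, map_add]
    monotone' := by
      intro a b h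
      obtain ⟨n, x, y, rfl, rfl⟩ := exists_mk₂ f a b
      rw [mk_le_mk] at h
      exact (g n).monotone' h }

lemma lift_of (g : ∀ n, X n →+*o K) (hg : ∀ n x, g (n + 1) (f n x) = g n x) (n : ℕ) (x : X n) :
    lift g hg (of f n x) = g n x := rfl

end lift

section map

variable {f} {Y : ℕ → Type u} [∀ n, Field (Y n)] [∀ n, LinearOrder (Y n)]
  {f' : ∀ n, Y n →+*o Y (n + 1)}

/-- The map between unions induced by a map of chains. -/
def map (g : ∀ n, X n →+*o Y n) (hg : ∀ n x, g (n + 1) (f n x) = f' n (g n x)) :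
    ChainUnion f →+*o ChainUnion f' :=
  lift (fun n => (of f' n).comp (g n)) fun n x => by
    rw [OrderRingHom.comp_apply, OrderRingHom.comp_apply, hg, of_succ]

lemma map_of (g : ∀ n, X n →+*o Y n) (hg : ∀ n x, g (n + 1) (f n x) = f' n (g n x)) (n : ℕ)
    (x : X n) : map g hg (of f n x) = of f' n (g n x) := rfl

end map

section order

variable [∀ n, IsStrictOrderedRing (X n)]

instance : IsOrderedAddMonoid (ChainUnion f) where
  add_le_add_left a b h c := by
    obtain ⟨n, x, y, z, rfl, rfl, rfl⟩ := exists_mk₃ f a b c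
    rw [← mk_add, ← mk_add, mk_le_mk]
    rw [mk_le_mk] at h
    gcongr

instance : ZeroLEOneClass (ChainUnion f) where
  zero_le_one := by
    rw [← map_zero (of f 0), ← map_one (of f 0)]
    exact (of f 0).monotone' zero_le_one

instance : IsOrderedRing (ChainUnion f) :=
  .of_mul_nonneg fun a b ha hb => by
    obtain ⟨n, x, y, rfl, rfl⟩ := exists_mk₂ f a b
    have h0 : (0 : ChainUnion f) = mk f n 0 := (map_zero (of f n)).symm
    rw [h0, mk_le_mk] at ha hb
    rw [h0, ← mk_mul, mk_le_mk]
    exact mul_nonneg ha hb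

instance : IsStrictOrderedRing (ChainUnion f) := IsOrderedRing.toIsStrictOrderedRing _

end order

end ChainUnion
end Chain

section Series

variable {Γ Γ' Γ'' : Type u}
variable [AddCommGroup Γ] [LinearOrder Γ] [IsOrderedAddMonoid Γ]
variable [AddCommGroup Γ'] [LinearOrder Γ'] [IsOrderedAddMonoid Γ']
variable [AddCommGroup Γ''] [LinearOrder Γ''] [IsOrderedAddMonoid Γ'']

variable (Γ Γ') in
/-- Embeddings of ordered abelian groups. -/
structure OrderedGroupEmb extends Γ →+ Γ' where
  strictMono : StrictMono toFun

instance : CoeFun (OrderedGroupEmb Γ Γ') (fun _ => Γ → Γ') := ⟨fun φ => φ.toFun⟩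

variable {k : Type u} [Field k] [LinearOrder k]

/-! ### Generalized power series

Convention: a group `G` of monomials is written additively and with the reversed order. So `G` is
given by an additive ordered abelian group `Γ`, whose elements `γ` stand for the monomials `t^γ`,
with `t^γ · t^δ = t^(γ + δ)`, and `t^γ > t^δ` iff `γ < δ`; in particular `t^γ > 1` iff `γ < 0`.
Anti-well-ordered sets of monomials become well-ordered subsets of `Γ`, so that `k((G))` is the
field of Hahn series `HahnSeries Γ k`. A nonzero series is positive iff the coefficient of its
largest monomial is positive; this is the order on `Lex (HahnSeries Γ k)`. -/

/-- The ordered field `k((G))` of generalized power series. -/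
abbrev GenSeries (k Γ : Type u) [Zero k] [PartialOrder Γ] : Type u := Lex (HahnSeries Γ k)

variable (k) in
/-- The monomial `t^γ`. -/
def monomial (γ : Γ) : GenSeries k Γ := toLex (HahnSeries.single γ 1)

/-- The constant series. -/
def const (c : k) : GenSeries k Γ := toLex (HahnSeries.C c)

/-- The support of a series (as a set of exponents). -/
def supp (f : GenSeries k Γ) : Set Γ := (ofLex f).support

variable (k) in
/-- `k((S))`: the series with support in `S`. -/
def seriesOn (S : Set Γ) : AddSubgroup (GenSeries k Γ) where
  carrier := {f | supp f ⊆ S}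
  zero_mem' := by simp [supp]
  add_mem' {f g} hf hg := (HahnSeries.support_add_subset (x := ofLex f) (y := ofLex g)).trans
    (Set.union_subset hf hg)
  neg_mem' {f} hf := by
    have : supp (-f) = supp f := HahnSeries.support_neg (x := ofLex f)
    simpa [this] using hf

/-- The purely infinite series `k((G^{>1}))`: all monomials are `> 1`. -/
abbrev purelyInf (k Γ : Type u) [Field k] [LinearOrder k] [AddCommGroup Γ] [LinearOrder Γ] :
    AddSubgroup (GenSeries k Γ) := seriesOn k (Set.Iio (0 : Γ))

/-- The part of a series supported in `S`. -/
def part (S : Set Γ) (f : GenSeries k Γ) : GenSeries k Γ :=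
  toLex (HahnSeries.mk (S.indicator (ofLex f).coeff)
    ((ofLex f).isPWO_support.mono fun γ h h' => h (by simp [h'])))

lemma part_mem (S : Set Γ) (f : GenSeries k Γ) : part S f ∈ seriesOn k S := by
  intro γ h
  by_contra h'
  exact h (Set.indicator_of_notMem h' _)

/-- The map `∑ a_γ t^γ ↦ ∑ a_γ t^{φ γ}` induced by an embedding `φ` of ordered groups. -/
def push (φ : OrderedGroupEmb Γ Γ') : GenSeries k Γ →+*o GenSeries k Γ' where
  toFun f := toLex (HahnSeries.embDomainRingHom φ.toAddMonoidHom φ.strictMono.injective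
    (fun _ _ => φ.strictMono.le_iff_le) (ofLex f))
  map_one' := congrArg toLex (map_one _)
  map_zero' := congrArg toLex (map_zero _)
  map_mul' f g := congrArg toLex (map_mul _ (ofLex f) (ofLex g))
  map_add' f g := congrArg toLex (map_add _ (ofLex f) (ofLex g))
  monotone' := (HahnSeries.embDomainOrderEmbedding (R := k)
    (OrderEmbedding.ofStrictMono φ.toFun φ.strictMono)).monotone

lemma push_strictMono (φ : OrderedGroupEmb Γ Γ') : StrictMono (push (k := k) φ) :=
  (HahnSeries.embDomainOrderEmbedding (R := k)
    (OrderEmbedding.ofStrictMono φ.toFun φ.strictMono)).strictMono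

lemma push_coeff (φ : OrderedGroupEmb Γ Γ') (f : GenSeries k Γ) (γ : Γ) :
    (ofLex (push φ f)).coeff (φ γ) = (ofLex f).coeff γ :=
  HahnSeries.embDomain_coeff (f := OrderEmbedding.ofStrictMono φ.toFun φ.strictMono)

lemma supp_push (φ : OrderedGroupEmb Γ Γ') (f : GenSeries k Γ) :
    supp (push φ f) ⊆ φ '' supp f :=
  HahnSeries.support_embDomain_subset (f := OrderEmbedding.ofStrictMono φ.toFun φ.strictMono)

lemma push_monomial (φ : OrderedGroupEmb Γ Γ') (γ : Γ) :
    push φ (monomial k γ) = monomial k (φ γ) :=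
  congrArg toLex
    (HahnSeries.embDomain_single (f := OrderEmbedding.ofStrictMono φ.toFun φ.strictMono))

lemma push_ext (φ : OrderedGroupEmb Γ Γ') (f : GenSeries k Γ) (g : GenSeries k Γ')
    (h : ∀ γ, (ofLex g).coeff (φ γ) = (ofLex f).coeff γ) (hs : supp g ⊆ Set.range φ) :
    push φ f = g := by
  refine ofLex.injective (HahnSeries.ext (funext fun γ => ?_))
  by_cases hγ : γ ∈ Set.range φ
  · obtain ⟨δ, rfl⟩ := hγ
    rw [push_coeff, h]
  · have h1 : γ ∉ supp g := fun h' => hγ (hs h')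
    have h2 : γ ∉ supp (push φ f) := fun h' =>
      hγ ((Set.image_subset_range _ _) (supp_push φ f h'))
    simp only [supp, HahnSeries.mem_support, not_not] at h1 h2
    rw [h1, h2]

/-- If `φ ∘ ψ = ψ' ∘ φ'` on exponents then the same holds for the induced maps on series. -/
lemma push_push {Δ : Type u} [AddCommGroup Δ] [LinearOrder Δ] [IsOrderedAddMonoid Δ]
    (φ : OrderedGroupEmb Γ Γ') (ψ : OrderedGroupEmb Γ' Γ'')
    (φ' : OrderedGroupEmb Γ Δ) (ψ' : OrderedGroupEmb Δ Γ'')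
    (h : ∀ γ, ψ (φ γ) = ψ' (φ' γ)) (f : GenSeries k Γ) :
    push ψ (push φ f) = push ψ' (push φ' f) := by
  have key : ∀ γ, (ofLex (push ψ' (push φ' f))).coeff (ψ (φ γ)) = (ofLex f).coeff γ := by
    intro γ
    rw [h, push_coeff, push_coeff]
  refine push_ext ψ _ _ (fun γ => ?_) ?_
  · by_cases hγ : γ ∈ Set.range φ
    · obtain ⟨δ, rfl⟩ := hγ
      rw [key, push_coeff]
    · have h2 : γ ∉ supp (push φ f) := fun h' =>
        hγ ((Set.image_subset_range _ _) (supp_push φ f h'))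
      have h1 : ψ γ ∉ supp (push ψ' (push φ' f)) := by
        intro h'
        obtain ⟨δ, hδ, e⟩ := supp_push ψ' _ h'
        obtain ⟨ε, -, rfl⟩ := supp_push φ' _ hδ
        rw [← h] at e
        exact hγ ⟨ε, ψ.strictMono.injective e⟩
      simp only [supp, HahnSeries.mem_support, not_not] at h1 h2
      rw [h1, h2]
  · intro γ h'
    obtain ⟨δ, hδ, rfl⟩ := supp_push ψ' _ h'
    obtain ⟨ε, -, rfl⟩ := supp_push φ' _ hδ
    exact ⟨φ ε, h ε⟩

lemma push_mem (φ : OrderedGroupEmb Γ Γ') {S : Set Γ} {S' : Set Γ'} (h : ∀ γ ∈ S, φ γ ∈ S')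
    {f : GenSeries k Γ} (hf : f ∈ seriesOn k S) : push φ f ∈ seriesOn k S' := by
  intro γ hγ
  obtain ⟨δ, hδ, rfl⟩ := supp_push φ f hγ
  exact h δ (hf hδ)

lemma push_purelyInf (φ : OrderedGroupEmb Γ Γ') {f : GenSeries k Γ} (hf : f ∈ purelyInf k Γ) :
    push φ f ∈ purelyInf k Γ' :=
  push_mem φ (fun γ (hγ : γ < 0) =>
    (φ.strictMono hγ).trans_eq (map_zero φ.toAddMonoidHom) : ∀ γ ∈ Set.Iio (0 : Γ), φ γ < 0) hf

/-- The series `∑ a_{φ γ} t^γ` obtained from `∑ a_δ t^δ` by restriction along `φ`: on series with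
support in the image of `φ`, this is the inverse of `push φ`. -/
def pull (φ : OrderedGroupEmb Γ Γ') (f : GenSeries k Γ') : GenSeries k Γ :=
  toLex (HahnSeries.mk (fun γ => (ofLex f).coeff (φ γ)) (by
    have h : (φ.toFun ⁻¹' (ofLex f).support).IsWF := by
      rw [Set.isWF_iff_no_descending_seq]
      exact fun s hs hs' => Set.isWF_iff_no_descending_seq.1 (ofLex f).isWF_support
        (fun n => φ (s n)) (fun a b hab => φ.strictMono (hs hab)) hs'
    exact h.isPWO))

variable (k) in
/-- The multiplicative copy `e[k((S))] = {e(α) : α ∈ k((S))}` of the ordered group `k((S))`, with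
`e(α) e(β) = e(α + β)` and `e(α) < e(β)` iff `α < β`. As for all groups of monomials, it is
written additively and with the reversed order. -/
def ExpCopy (S : Set Γ) : Type u := (seriesOn k S)ᵒᵈ

namespace ExpCopy

variable [IsStrictOrderedRing k] {S : Set Γ}

instance : AddCommGroup (ExpCopy k S) := inferInstanceAs (AddCommGroup (seriesOn k S)ᵒᵈ)
instance : LinearOrder (ExpCopy k S) := inferInstanceAs (LinearOrder (seriesOn k S)ᵒᵈ)
instance : IsOrderedAddMonoid (ExpCopy k S) :=
  inferInstanceAs (IsOrderedAddMonoid (seriesOn k S)ᵒᵈ)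

/-- The formal exponential `e(α)`. -/
def e (α : seriesOn k S) : ExpCopy k S := OrderDual.toDual α

/-- The exponent `α` of the formal exponential `e(α)`, as a series. -/
def log (g : ExpCopy k S) : GenSeries k Γ := (OrderDual.ofDual g).1

lemma log_mem (g : ExpCopy k S) : log g ∈ seriesOn k S := (OrderDual.ofDual g).2

@[simp] lemma log_e (α : seriesOn k S) : log (e α) = α.1 := rfl

lemma log_injective : Function.Injective (log : ExpCopy k S → GenSeries k Γ) :=
  fun _ _ h => OrderDual.ofDual.injective (Subtype.ext h)

lemma log_zero : log (0 : ExpCopy k S) = 0 := rfl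

lemma log_add (g h : ExpCopy k S) : log (g + h) = log g + log h := rfl

lemma log_lt_log (g h : ExpCopy k S) : log g < log h ↔ h < g := Iff.rfl

variable (k S) in
/-- The exponents as a group homomorphism. -/
def logHom : ExpCopy k S →+ GenSeries k Γ where
  toFun := log
  map_zero' := log_zero
  map_add' := log_add

/-- The map `e(α) ↦ e(φ(α))` induced by an embedding `φ` of ordered groups taking `S` into
`S'`. -/
def map (φ : OrderedGroupEmb Γ Γ') {S' : Set Γ'} (h : ∀ γ ∈ S, φ γ ∈ S') :
    OrderedGroupEmb (ExpCopy k S) (ExpCopy k S') where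
  toFun g := e ⟨push φ (log g), push_mem φ h (log_mem g)⟩
  map_zero' := log_injective (map_zero (push φ))
  map_add' f g := log_injective (map_add (push φ) (log f) (log g))
  strictMono f g h' := (log_lt_log _ _).1 (push_strictMono φ ((log_lt_log g f).2 h'))

end ExpCopy

/-- The exponents `γ` such that the monomial `t^γ` is larger than all `t^u`, `u ∈ U`. -/
def larger (U : AddSubgroup Γ) : Set Γ := {γ | ∀ u ∈ U, γ < u}

/-- The exponents `γ` such that the monomial `t^γ` is smaller than all `t^u`, `u ∈ U`. -/
def smaller (U : AddSubgroup Γ) : Set Γ := {γ | ∀ u ∈ U, u < γ}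

/-- The sum `∑ c_i ε^i`, for `ε` infinitesimal. -/
def subst (c : ℕ → k) (ε : GenSeries k Γ) : GenSeries k Γ :=
  toLex (PowerSeries.heval (ofLex ε) (PowerSeries.mk c))

end Series

/-- A series field `k((G))` with a prelogarithmic section `l : G → k((G^{>1}))`, an embedding of
ordered groups. -/
structure PrelogField (k : Type u) [Field k] [LinearOrder k] where
  /-- the group `G`, written additively and with the reversed order -/
  Γ : Type u
  [addCommGroup : AddCommGroup Γ]
  [linearOrder : LinearOrder Γ]
  [isOrderedAddMonoid : IsOrderedAddMonoid Γ]
  /-- the prelogarithmic section -/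
  l : Γ →+ purelyInf k Γ
  l_strictAnti : StrictAnti l

attribute [instance] PrelogField.addCommGroup PrelogField.linearOrder
  PrelogField.isOrderedAddMonoid

namespace PrelogField

variable {k : Type u} [Field k] [LinearOrder k] [IsStrictOrderedRing k]

/-- The embedding `G → G^#`, `g ↦ e(l(g))`. -/
def incl (P : PrelogField k) : OrderedGroupEmb P.Γ (ExpCopy k (Set.Iio (0 : P.Γ))) where
  toFun γ := ExpCopy.e (P.l γ)
  map_zero' := congrArg ExpCopy.e (map_zero P.l)
  map_add' γ δ := congrArg ExpCopy.e (map_add P.l γ δ)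
  strictMono _ _ h := (ExpCopy.log_lt_log _ _).1 (P.l_strictAnti h)

/-- The exponential extension: `G^#` is the multiplicative copy `e[k((G^{>1}))]` of `k((G^{>1}))`,
in which `g ∈ G` is identified with `e(l(g))`, and `l^#(e(α)) = α`. -/
def ext (P : PrelogField k) : PrelogField k where
  Γ := ExpCopy k (Set.Iio (0 : P.Γ))
  l :=
    { toFun := fun g => ⟨push P.incl (ExpCopy.log g), push_purelyInf P.incl (ExpCopy.log_mem g)⟩
      map_zero' := Subtype.ext (map_zero (push P.incl))
      map_add' := fun g h => Subtype.ext (map_add (push P.incl) (ExpCopy.log g) (ExpCopy.log h)) }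
  l_strictAnti g h hgh := push_strictMono P.incl ((ExpCopy.log_lt_log h g).2 hgh)

/-- The iterated exponential extensions `k((G^{#n}))`. -/
def iter (P : PrelogField k) : ℕ → PrelogField k
  | 0 => P
  | n + 1 => (P.iter n).ext

/-- The inclusion `G^{#n} → G^{#(n+1)}`. -/
def inclIter (P : PrelogField k) (n : ℕ) : OrderedGroupEmb (P.iter n).Γ (P.iter (n + 1)).Γ :=
  (P.iter n).incl

/-- Morphisms of series fields with prelogarithmic sections. -/
structure Hom (P Q : PrelogField k) extends OrderedGroupEmb P.Γ Q.Γ where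
  comm : ∀ γ, push toOrderedGroupEmb (P.l γ).1 = (Q.l (toFun γ)).1

namespace Hom

variable {P Q : PrelogField k}

lemma map_neg (ψ : Hom P Q) : ∀ γ ∈ Set.Iio (0 : P.Γ), ψ.toFun γ ∈ Set.Iio (0 : Q.Γ) :=
  fun _ hγ => (ψ.strictMono hγ).trans_eq (map_zero ψ.toAddMonoidHom)

/-- The morphism `ψ^#`, given by `e(α) ↦ e(ψ(α))`. -/
def ext (ψ : Hom P Q) : Hom P.ext Q.ext where
  toOrderedGroupEmb := ExpCopy.map ψ.toOrderedGroupEmb ψ.map_neg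
  comm g := push_push P.incl (ExpCopy.map ψ.toOrderedGroupEmb ψ.map_neg) ψ.toOrderedGroupEmb
    Q.incl (fun γ => ExpCopy.log_injective (ψ.comm γ)) (ExpCopy.log g)

/-- The morphism `ψ^{#n}`. -/
def iter (ψ : Hom P Q) : ∀ n, Hom (P.iter n) (Q.iter n)
  | 0 => ψ
  | n + 1 => (ψ.iter n).ext

lemma iter_incl (ψ : Hom P Q) (n : ℕ) (γ : (P.iter n).Γ) :
    (ψ.iter (n + 1)).toOrderedGroupEmb (P.inclIter n γ)
      = Q.inclIter n ((ψ.iter n).toOrderedGroupEmb γ) :=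
  ExpCopy.log_injective ((ψ.iter n).comm γ)

end Hom

variable (expk : k → k)

/-- The prelogarithm `L(g·a·(1 + ε)) = l(g) + log a + ∑_{i ≥ 1} (-1)^(i-1) ε^i / i` of `k((G))`,
where `g` is a monomial, `a` a positive constant, `ε` is infinitesimal, and `log` is the inverse of
the exponential `expk` of `k`. Only its values at positive series matter. -/
def prelog (P : PrelogField k) (f : GenSeries k P.Γ) : GenSeries k P.Γ :=
  let γ := (ofLex f).order
  let a := (ofLex f).leadingCoeff
  (P.l γ).1 + const (Function.invFun expk a)
    + subst (fun i => (-1) ^ (i + 1) / (i : k)) (f * (monomial k γ * const a)⁻¹ - 1)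

/-- The field `k((G))^EL`, the union of the fields `k((G^{#n}))`. -/
abbrev EL (P : PrelogField k) : Type u :=
  ChainUnion (X := fun n => GenSeries k (P.iter n).Γ) (fun n => push (P.inclIter n))

namespace EL

/-- The logarithm of `k((G))^EL`, the union of the prelogarithms of the fields `k((G^{#n}))`: it is
computed in any of these fields which contains the given element. -/
def log (P : PrelogField k) (a : P.EL) : P.EL :=
  let h := ChainUnion.exists_of _ a
  ChainUnion.of _ h.choose ((P.iter h.choose).prelog expk h.choose_spec.choose)

/-- The exponential of `k((G))^EL`, the inverse of the logarithm. -/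
def exp (P : PrelogField k) : P.EL → P.EL := Function.invFunOn (log expk P) (Set.Ioi 0)

/-- The constants `k ⊆ k((G))^EL`. -/
def const (P : PrelogField k) (c : k) : P.EL := ChainUnion.of _ 0 (LESeries.const c)

/-- The monomials `G ⊆ k((G))^EL`. -/
def monomial (P : PrelogField k) (γ : P.Γ) : P.EL := ChainUnion.of _ 0 (LESeries.monomial k γ)

end EL

/-- The map `ψ^EL`, the union of the maps `ψ^{#n}`. -/
def Hom.EL {P Q : PrelogField k} (ψ : Hom P Q) : P.EL →+*o Q.EL :=
  ChainUnion.map (fun n => push (ψ.iter n).toOrderedGroupEmb)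
    (fun n => push_push (P.inclIter n) (ψ.iter (n + 1)).toOrderedGroupEmb
      (ψ.iter n).toOrderedGroupEmb (Q.inclIter n) (ψ.iter_incl n))

section LE

variable (P : PrelogField k)

/-- For a subgroup `H` of `G`, the pair `(G^{n-1}, G^n)` of subgroups of `G^{#n}`, where
`G^{-1} = 1`, `G^0 = H` and `G^{n+1} = G^n · Exp k(((G^n)^{> G^{n-1}}))`. Note that
`Exp α = e(α)` for `α ∈ k((G^{#n, >1}))`, as `l^#(e(α)) = α`. -/
def chainPair (H : AddSubgroup P.Γ) :
    ∀ n, AddSubgroup (P.iter n).Γ × AddSubgroup (P.iter n).Γ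
  | 0 => (⊥, H)
  | n + 1 =>
    let U := (chainPair H n).1
    let G := (chainPair H n).2
    let G' : AddSubgroup (P.iter (n + 1)).Γ := G.map (P.inclIter n).toAddMonoidHom
    let expG : AddSubgroup (P.iter (n + 1)).Γ :=
      (seriesOn k (G ∩ larger U)).comap (ExpCopy.logHom k (Set.Iio (0 : (P.iter n).Γ)))
    (G', G' ⊔ expG)

/-- The group `G_m^n`, for a subgroup `H` of `G` and a morphism `ψ`; here `G_m^0 = ψ^(m)(H)`. -/
def group (H : AddSubgroup P.Γ) (ψ : Hom P P) (m n : ℕ) : AddSubgroup (P.iter n).Γ :=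
  (P.chainPair ((AddSubgroup.map ψ.toAddMonoidHom)^[m] H) n).2

/-- `L_m = ⋃ₙ k((G_m^n))` -/
def L (H : AddSubgroup P.Γ) (ψ : Hom P P) (m : ℕ) : Set P.EL :=
  {a | ∃ n, ∃ f ∈ seriesOn k (P.group H ψ m n : Set (P.iter n).Γ), a = ChainUnion.of _ n f}

/-- `LE(H, ψ) = ⋃ₘ L_m` -/
def LE (H : AddSubgroup P.Γ) (ψ : Hom P P) : Set P.EL := ⋃ m, P.L H ψ m

end LE

end PrelogField

/-! ### The series fields over Hahn groups and over logarithmic words -/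

section Examples

variable {k : Type u} [Field k] [LinearOrder k] [IsStrictOrderedRing k]

/-- The map `∑ r_j t^j ↦ ∑ r_j t^{ε j}`, for an increasing family of infinite monomials. -/
def embSection {J : Type v} [LinearOrder J] {Γ : Type u} [AddCommGroup Γ] [LinearOrder Γ]
    (ε : J ↪o Γ) (hε : ∀ j, ε j < 0) : Lex (HahnSeries J k) →+ purelyInf k Γ where
  toFun f := ⟨toLex (HahnSeries.embDomain ε (ofLex f)), by
    intro γ hγ
    obtain ⟨j, -, rfl⟩ := HahnSeries.support_embDomain_subset hγ
    exact hε j⟩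
  map_zero' := Subtype.ext (congrArg toLex HahnSeries.embDomain_zero)
  map_add' f g := Subtype.ext (congrArg toLex (HahnSeries.embDomain_add ε (ofLex f) (ofLex g)))

lemma embSection_strictMono {J : Type v} [LinearOrder J] {Γ : Type u} [AddCommGroup Γ]
    [LinearOrder Γ] (ε : J ↪o Γ) (hε : ∀ j, ε j < 0) :
    StrictMono (embSection (k := k) ε hε) :=
  (HahnSeries.embDomainOrderEmbedding (R := k) ε).strictMono

/-! #### Hahn groups -/

variable (k) in
/-- The Hahn group `I^k` of formal products `∏ x_i^{g_i}` with anti-well-ordered support, ordered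
anti-lexicographically; here written additively and with the reversed order. The product is
represented by the family `(g_i)`. -/
def HahnGroup (I : Type u) [LinearOrder I] : Type u := (Lex (HahnSeries Iᵒᵈ k))ᵒᵈ

namespace HahnGroup

variable {I : Type u} [LinearOrder I]

instance : AddCommGroup (HahnGroup k I) :=
  inferInstanceAs (AddCommGroup (Lex (HahnSeries Iᵒᵈ k))ᵒᵈ)
instance : LinearOrder (HahnGroup k I) :=
  inferInstanceAs (LinearOrder (Lex (HahnSeries Iᵒᵈ k))ᵒᵈ)
instance : IsOrderedAddMonoid (HahnGroup k I) :=
  inferInstanceAs (IsOrderedAddMonoid (Lex (HahnSeries Iᵒᵈ k))ᵒᵈ)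

/-- The product `∏ x_i^{g_i}` -/
def mk (g : Lex (HahnSeries Iᵒᵈ k)) : HahnGroup k I := OrderDual.toDual g

variable (k I) in
/-- The family of exponents of a product. -/
def exponents : HahnGroup k I →+ Lex (HahnSeries Iᵒᵈ k) where
  toFun g := OrderDual.ofDual g
  map_zero' := rfl
  map_add' _ _ := rfl

lemma exponents_strictAnti : StrictAnti (exponents k I) := fun _ _ h => h

variable (k) in
/-- The generator `x_i` of the Hahn group. -/
def gen (i : I) : HahnGroup k I := mk (toLex (HahnSeries.single (OrderDual.toDual i) 1))

lemma gen_strictAnti : StrictAnti (gen k : I → HahnGroup k I) := by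
  intro i j h
  refine (⟨OrderDual.toDual j, fun a ha => ?_, ?_⟩ :
    (toLex (HahnSeries.single (OrderDual.toDual i) 1) : Lex (HahnSeries Iᵒᵈ k))
      < toLex (HahnSeries.single (OrderDual.toDual j) 1))
  · have ha' : a < OrderDual.toDual i := ha.trans h
    simp [HahnSeries.coeff_single_of_ne ha.ne, HahnSeries.coeff_single_of_ne ha'.ne]
  · have h' : OrderDual.toDual j ≠ OrderDual.toDual i := by simpa using h.ne'
    simp [HahnSeries.coeff_single_of_ne h']

lemma gen_neg (i : I) : gen k i < 0 := by
  refine (⟨OrderDual.toDual i, fun a ha => ?_, ?_⟩ :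
    (0 : Lex (HahnSeries Iᵒᵈ k)) < toLex (HahnSeries.single (OrderDual.toDual i) 1))
  · simp [HahnSeries.coeff_single_of_ne ha.ne]
  · simp

variable (k) in
/-- For `σ : I → I` strictly increasing, the order embedding `i ↦ x_{σ i}`. -/
def genEmb (σ : I → I) (hσ : StrictMono σ) : Iᵒᵈ ↪o HahnGroup k I :=
  OrderEmbedding.ofStrictMono (fun i => gen k (σ (OrderDual.ofDual i)))
    (fun _ _ h => gen_strictAnti (hσ h))

lemma genEmb_neg (σ : I → I) (hσ : StrictMono σ) (i : Iᵒᵈ) : genEmb k σ hσ i < 0 := gen_neg _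

end HahnGroup

variable (k) in
/-- The series field over the Hahn group `I^k`, with the prelogarithmic section
`l_σ(∏ x_i^{g_i}) = ∑ g_i x_{σ i}` induced by an embedding `σ : I → I` of ordered sets. -/
def hahnField (I : Type u) [LinearOrder I] (σ : I → I) (hσ : StrictMono σ) : PrelogField k where
  Γ := HahnGroup k I
  l := (embSection (HahnGroup.genEmb k σ hσ) (HahnGroup.genEmb_neg σ hσ)).comp
    (HahnGroup.exponents k I)
  l_strictAnti _ _ h := embSection_strictMono (HahnGroup.genEmb k σ hσ)
    (HahnGroup.genEmb_neg σ hσ) (HahnGroup.exponents_strictAnti h)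

/-! #### Logarithmic words -/

variable (k) in
/-- The group of logarithmic words `x^{r_0} (log x)^{r_1} ⋯ (log_n x)^{r_n}`, `r_i ∈ k`, ordered
lexicographically, so that `x > (log x)^r > (log_2 x)^s > ⋯` for all `r, s, … > 0`; here written
additively and with the reversed order. The word is represented by the family `(r_i)`. -/
def Word : Type u := (Lex (ℕ →₀ k))ᵒᵈ

namespace Word

instance : AddCommGroup (Word k) := inferInstanceAs (AddCommGroup (Lex (ℕ →₀ k))ᵒᵈ)
instance : LinearOrder (Word k) := inferInstanceAs (LinearOrder (Lex (ℕ →₀ k))ᵒᵈ)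
instance : IsOrderedAddMonoid (Word k) :=
  inferInstanceAs (IsOrderedAddMonoid (Lex (ℕ →₀ k))ᵒᵈ)

/-- The word with exponents `r_i`. -/
def mk (r : ℕ →₀ k) : Word k := OrderDual.toDual (toLex r)

/-- The exponents of a word. -/
def exponents (w : Word k) : ℕ →₀ k := ofLex (OrderDual.ofDual w)

lemma exponents_add (v w : Word k) : (v + w).exponents = v.exponents + w.exponents := rfl

lemma exponents_injective : Function.Injective (exponents (k := k)) :=
  fun _ _ h => OrderDual.ofDual.injective (ofLex.injective h)

lemma lt_iff (v w : Word k) : v < w ↔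
    ∃ i, (∀ j, j < i → w.exponents j = v.exponents j) ∧ w.exponents i < v.exponents i := Iff.rfl

/-- The word `(log_i x)^r`. -/
def logPow (i : ℕ) (r : k) : Word k := mk (Finsupp.single i r)

variable (k) in
lemma logPow_strictMono : StrictMono (fun i => logPow i (1 : k)) := by
  intro i j h
  refine (lt_iff _ _).2 ⟨i, fun a ha => ?_, ?_⟩
  · simp [logPow, exponents, mk, ha.ne', (ha.trans h).ne']
  · simp [logPow, exponents, mk, h.ne']

lemma logPow_neg (i : ℕ) : logPow i (1 : k) < 0 := by
  refine (lt_iff _ _).2 ⟨i, fun a ha => ?_, ?_⟩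
  · simp [logPow, exponents, mk, ha.ne']
    rfl
  · simp [logPow, exponents, mk]
    exact zero_lt_one

variable (k) in
/-- The order embedding `i ↦ log_{i+1} x`. -/
def logEmb : ℕ ↪o Word k :=
  OrderEmbedding.ofStrictMono (fun i => logPow (i + 1) 1)
    (fun _ _ h => logPow_strictMono k (Nat.succ_lt_succ h))

lemma logEmb_neg (i : ℕ) : logEmb k i < 0 := logPow_neg _

variable (k) in
/-- The family of exponents of a word as a series over the index set `ℕ`. -/
def series : Word k →+ Lex (HahnSeries ℕ k) where
  toFun w := toLex (HahnSeries.mk w.exponents (Set.IsWF.of_wellFoundedLT _).isPWO)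
  map_zero' := rfl
  map_add' _ _ := rfl

lemma series_strictAnti : StrictAnti (series k) := fun _ _ h => h

lemma series_coeff (w : Word k) (i : ℕ) : (ofLex (series k w)).coeff i = w.exponents i := rfl

variable (k) in
/-- The shift `log_i x ↦ log_{i+1} x` -/
def shift : OrderedGroupEmb (Word k) (Word k) where
  toFun w := mk (w.exponents.mapDomain Nat.succ)
  map_zero' := rfl
  map_add' v w := exponents_injective Finsupp.mapDomain_add
  strictMono v w h := by
    have hs : ∀ (u : Word k) i, (mk (u.exponents.mapDomain Nat.succ)).exponents (i + 1)
        = u.exponents i := fun u i => Finsupp.mapDomain_apply Nat.succ_injective _ i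
    have h0 : ∀ (u : Word k), (mk (u.exponents.mapDomain Nat.succ)).exponents 0 = 0 :=
      fun u => Finsupp.mapDomain_of_notMem_range _ _ (by simp)
    obtain ⟨i, h1, h2⟩ := (lt_iff _ _).1 h
    refine (lt_iff _ _).2 ⟨i + 1, fun j hj => ?_, ?_⟩
    · rcases j with _ | j
      · exact (h0 w).trans (h0 v).symm
      · exact (hs w j).trans ((h1 j (by omega)).trans (hs v j).symm)
    · exact (hs w i).trans_lt (h2.trans_eq (hs v i).symm)

lemma shift_exponents_succ (w : Word k) (i : ℕ) :
    (shift k w).exponents (i + 1) = w.exponents i :=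
  Finsupp.mapDomain_apply Nat.succ_injective _ i

lemma shift_exponents_zero (w : Word k) : (shift k w).exponents 0 = 0 :=
  Finsupp.mapDomain_of_notMem_range _ _ (by simp)

lemma shift_logPow (i : ℕ) (r : k) : shift k (logPow i r) = logPow (i + 1) r :=
  exponents_injective Finsupp.mapDomain_single

end Word

variable (k) in
/-- The series field over the group of logarithmic words, with the prelogarithmic section
`l(∏ (log_i x)^{r_i}) = ∑ r_i log_{i+1} x`. -/
def logWords : PrelogField k where
  Γ := Word k
  l := (embSection (Word.logEmb k) Word.logEmb_neg).comp (Word.series k)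
  l_strictAnti _ _ h := embSection_strictMono (Word.logEmb k) Word.logEmb_neg
    (Word.series_strictAnti h)

lemma logWords_l_coeff (w : Word k) (i : ℕ) :
    (ofLex ((logWords k).l w).1).coeff (Word.logEmb k i) = w.exponents i :=
  HahnSeries.embDomain_coeff

lemma logWords_l_supp (w : Word k) :
    supp ((logWords k).l w).1 ⊆ Word.logEmb k '' {i | w.exponents i ≠ 0} :=
  HahnSeries.support_embDomain_subset

lemma shift_comm (w : Word k) :
    push (Word.shift k) ((logWords k).l w).1 = ((logWords k).l (Word.shift k w)).1 := by
  have hE : ∀ i, Word.shift k (Word.logEmb k i) = Word.logEmb k (i + 1) :=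
    fun i => Word.shift_logPow (i + 1) 1
  refine push_ext _ _ _ (fun γ => ?_) ?_
  · by_cases hγ : γ ∈ Set.range (Word.logEmb k)
    · obtain ⟨i, rfl⟩ := hγ
      rw [hE]
      exact (logWords_l_coeff _ _).trans
        ((Word.shift_exponents_succ w i).trans (logWords_l_coeff w i).symm)
    · have h1 : γ ∉ supp ((logWords k).l w).1 := fun h =>
        hγ (Set.image_subset_range _ _ (logWords_l_supp w h))
      have h2 : Word.shift k γ ∉ supp ((logWords k).l (Word.shift k w)).1 := by
        intro h
        obtain ⟨i, hi, e⟩ := logWords_l_supp _ h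
        rcases i with _ | i
        · exact hi (Word.shift_exponents_zero w)
        · rw [← hE] at e
          exact hγ ⟨i, (Word.shift k).strictMono.injective e⟩
      exact (not_not.1 h2).trans (not_not.1 h1).symm
  · intro γ h
    obtain ⟨i, hi, rfl⟩ := logWords_l_supp _ h
    rcases i with _ | i
    · exact absurd (Word.shift_exponents_zero w) hi
    · exact ⟨_, hE i⟩

variable (k) in
/-- The shift morphism
`ψ(x^{r_0} (log x)^{r_1} ⋯ (log_n x)^{r_n}) = (log x)^{r_0} ⋯ (log_{n+1} x)^{r_n}`. -/
def shift : PrelogField.Hom (logWords k) (logWords k) where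
  toOrderedGroupEmb := (Word.shift k :)
  comm w := shift_comm w

variable (k) in
/-- The subgroup `H = {x^r : r ∈ k}` of the group of logarithmic words. -/
def powersX : AddSubgroup (Word k) where
  carrier := {w | ∃ r : k, w = Word.logPow 0 r}
  zero_mem' := ⟨0, Word.exponents_injective (Finsupp.single_zero 0).symm⟩
  add_mem' := by
    rintro _ _ ⟨r, rfl⟩ ⟨s, rfl⟩
    exact ⟨r + s, Word.exponents_injective (Finsupp.single_add 0 r s).symm⟩
  neg_mem' := by
    rintro _ ⟨r, rfl⟩
    exact ⟨-r, Word.exponents_injective (Finsupp.single_neg 0 r).symm⟩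

end Examples

/-! ### The field of logarithmic-exponential series

This is the construction by Dahn and Göring, and by van den Dries, Macintyre and Marker. It does not
use the constructions above for prelogarithmic fields. -/

/-- A group `G` of monomials (written additively and with the reversed order) together with a
subgroup `U`. In the construction of the logarithmic-exponential series, these are `G_n` and
`G_{n-1}`. -/
structure EStage (k : Type u) where
  /-- the group `G` -/
  Γ : Type u
  [addCommGroup : AddCommGroup Γ]
  [linearOrder : LinearOrder Γ]
  [isOrderedAddMonoid : IsOrderedAddMonoid Γ]
  /-- the subgroup `U` -/
  U : AddSubgroup Γ

attribute [instance] EStage.addCommGroup EStage.linearOrder EStage.isOrderedAddMonoid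

namespace EStage

variable {k : Type u} [Field k] [LinearOrder k] [IsStrictOrderedRing k]

/-- From `G_{n-1} ⊆ G_n` to `G_n ⊆ G_{n+1}`: the group `G_{n+1}` is the product of `G_n` and of a
multiplicative copy `e[A_n]` of `A_n = k((G_n^{> G_{n-1}}))`, ordered anti-lexicographically, that
is, the factor `e[A_n]` dominates. -/
def next (S : EStage k) : EStage k where
  Γ := Lex (ExpCopy k (larger S.U) × S.Γ)
  U := (AddSubgroup.prod ⊥ ⊤ : AddSubgroup (ExpCopy k (larger S.U) × S.Γ))

lemma mem_next_U (S : EStage k) (p : Lex (ExpCopy k (larger S.U) × S.Γ)) :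
    p ∈ S.next.U ↔ (ofLex p).1 = 0 := by
  change ((ofLex p).1 ∈ (⊥ : AddSubgroup _) ∧ (ofLex p).2 ∈ (⊤ : AddSubgroup _)) ↔ _
  exact ⟨fun h => AddSubgroup.mem_bot.1 h.1, fun h => ⟨AddSubgroup.mem_bot.2 h, trivial⟩⟩

/-- The inclusion `G_n → G_{n+1}`. -/
def incl (S : EStage k) : OrderedGroupEmb S.Γ S.next.Γ where
  toFun γ := toLex (0, γ)
  map_zero' := rfl
  map_add' _ _ := congrArg toLex (Prod.ext (add_zero 0).symm rfl)
  strictMono _ _ h := Prod.Lex.toLex_lt_toLex.2 (Or.inr ⟨rfl, h⟩)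

/-- The monomial `e(α)` of `G_{n+1}`, for `α ∈ A_n`. -/
def e (S : EStage k) (α : seriesOn k (larger S.U)) : S.next.Γ := toLex (ExpCopy.e α, 0)

/-- Embeddings of groups compatible with the condition of being larger than the given subgroup. -/
structure Hom (S T : EStage k) extends OrderedGroupEmb S.Γ T.Γ where
  map_larger : ∀ γ ∈ larger S.U, toFun γ ∈ larger T.U

/-- An embedding extends to the next groups by `e(α) γ ↦ e(φ(α)) φ(γ)`. -/
def Hom.next {S T : EStage k} (φ : Hom S T) : Hom S.next T.next where
  toFun p := toLex (ExpCopy.map φ.toOrderedGroupEmb φ.map_larger (ofLex p).1, φ.toFun (ofLex p).2)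
  map_zero' := congrArg toLex (Prod.ext
    (map_zero (ExpCopy.map (k := k) φ.toOrderedGroupEmb φ.map_larger).toAddMonoidHom)
    (map_zero φ.toAddMonoidHom))
  map_add' p q := congrArg toLex (Prod.ext
    (map_add (ExpCopy.map (k := k) φ.toOrderedGroupEmb φ.map_larger).toAddMonoidHom
      (ofLex p).1 (ofLex q).1)
    (map_add φ.toAddMonoidHom (ofLex p).2 (ofLex q).2))
  strictMono p q h := by
    rcases Prod.Lex.lt_iff.1 h with h | ⟨h, h'⟩
    · exact Prod.Lex.toLex_lt_toLex.2 (Or.inl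
        ((ExpCopy.map (k := k) φ.toOrderedGroupEmb φ.map_larger).strictMono h))
    · exact Prod.Lex.toLex_lt_toLex.2 (Or.inr
        ⟨congrArg (ExpCopy.map (k := k) φ.toOrderedGroupEmb φ.map_larger) h, φ.strictMono h'⟩)
  map_larger p hp q hq := by
    have h := hp (toLex (0, (ofLex p).2)) ((mem_next_U S _).2 rfl)
    have h1 : (ofLex p).1 < 0 := by
      rcases Prod.Lex.lt_iff.1 h with h | ⟨-, h'⟩
      · exact h
      · exact absurd h' (lt_irrefl _)
    refine Prod.Lex.lt_iff.2 (Or.inl ?_)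
    rw [(mem_next_U T q).1 hq]
    exact ((ExpCopy.map (k := k) φ.toOrderedGroupEmb φ.map_larger).strictMono h1).trans_eq
      (map_zero (ExpCopy.map (k := k) φ.toOrderedGroupEmb φ.map_larger).toAddMonoidHom)

end EStage

section LEField

variable (k : Type u) [Field k] [LinearOrder k] [IsStrictOrderedRing k]

/-- The groups `G_n` (with the subgroups `G_{n-1}`): `G_0 = x^k` is a multiplicative copy of the
ordered group `k`, and `G_{-1} = 1`. -/
def stage : ℕ → EStage k
  | 0 => { Γ := kᵒᵈ, U := ⊥ }
  | n + 1 => (stage n).next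

/-- The inclusion `G_n → G_{n+1}`. -/
def stageIncl (n : ℕ) : OrderedGroupEmb (stage k n).Γ (stage k (n + 1)).Γ := (stage k n).incl

/-- The monomial `e(α)` of `G_{n+1}`, for `α ∈ A_n = k((G_n^{> G_{n-1}}))`. -/
def stageE (n : ℕ) (α : seriesOn k (larger (stage k n).U)) : (stage k (n + 1)).Γ :=
  (stage k n).e α

/-- The field `K_n = k((G_n))`. -/
abbrev KE (n : ℕ) : Type u := GenSeries k (stage k n).Γ

/-- The monomial `x^r` of `G_0 = x^k`. -/
def xPow (r : k) : (stage k 0).Γ := OrderDual.toDual r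

/-- The element `r x` of `A_0 = k((G_0^{>1}))`. -/
def smulX (r : k) : seriesOn k (larger (stage k 0).U) :=
  ⟨toLex (HahnSeries.single (xPow k 1) r), by
    intro γ hγ u hu
    have h : γ = xPow k 1 := HahnSeries.support_single_subset hγ
    rw [h, (AddSubgroup.mem_bot.1 hu : u = 0)]
    exact (zero_lt_one : (0 : k) < 1)⟩

lemma smulX_zero : smulX k 0 = 0 := Subtype.ext (congrArg toLex (HahnSeries.single_eq_zero))

lemma smulX_add (r s : k) : smulX k (r + s) = smulX k r + smulX k s :=
  Subtype.ext (congrArg toLex (HahnSeries.single_add (xPow k 1) r s))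

lemma smulX_strictMono : StrictMono (smulX k) := fun r s h =>
  (⟨xPow k 1, fun j hj => by
    simp [smulX, HahnSeries.coeff_single_of_ne hj.ne], by simpa [smulX] using h⟩ :
    (smulX k r).1 < (smulX k s).1)

/-- The substitution of `exp x` for `x` on `G_0`: `x^r ↦ e(r x)`. -/
def compExpZero : EStage.Hom (stage k 0) (stage k 1) where
  toFun r := (stage k 0).e (smulX k (OrderDual.ofDual r))
  map_zero' := congrArg (stage k 0).e (smulX_zero k)
  map_add' r s := (congrArg (stage k 0).e (smulX_add k _ _)).trans
    (congrArg toLex (Prod.ext rfl (add_zero 0).symm))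
  strictMono r s h := Prod.Lex.toLex_lt_toLex.2 (Or.inl (smulX_strictMono k h))
  map_larger r hr p hp := by
    have h : (0 : k) < OrderDual.ofDual r := hr 0 (AddSubgroup.zero_mem _)
    refine Prod.Lex.lt_iff.2 (Or.inl ?_)
    rw [((stage k 0).mem_next_U p).1 hp]
    exact (smulX_zero k).symm.trans_lt (smulX_strictMono k h)

/-- The substitution of `exp x` for `x` on `G_n`: `e(α) γ ↦ e(Φ(α)) Φ(γ)` -/
def compExpStage : ∀ n, EStage.Hom (stage k n) (stage k (n + 1))
  | 0 => compExpZero k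
  | n + 1 => (compExpStage n).next

/-- The field `k((x^{-1}))^E`, the union of the fields `K_n`. -/
abbrev EField : Type u := ChainUnion (X := KE k) (fun n => push (stageIncl k n))

lemma compExpStage_incl (n : ℕ) (γ : (stage k n).Γ) :
    (compExpStage k (n + 1)).toOrderedGroupEmb (stageIncl k n γ)
      = stageIncl k (n + 1) ((compExpStage k n).toOrderedGroupEmb γ) :=
  congrArg toLex (Prod.ext
    (map_zero (ExpCopy.map (k := k) (compExpStage k n).toOrderedGroupEmb
      (compExpStage k n).map_larger).toAddMonoidHom) rfl)

lemma compExpE_compat (n : ℕ) (f : KE k n) :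
    push (compExpStage k (n + 1)).toOrderedGroupEmb (push (stageIncl k n) f)
      = push (stageIncl k (n + 1)) (push (compExpStage k n).toOrderedGroupEmb f) :=
  push_push (stageIncl k n) (compExpStage k (n + 1)).toOrderedGroupEmb
    (compExpStage k n).toOrderedGroupEmb (stageIncl k (n + 1)) (compExpStage_incl k n) f

/-- The map `Φ` (substitution of `exp x` for `x`) on `k((x^{-1}))^E`. -/
def compExpE : EField k →+*o EField k :=
  ChainUnion.lift
    (fun n => (ChainUnion.of (X := KE k) (fun n => push (stageIncl k n)) (n + 1)).comp
      (push (compExpStage k n).toOrderedGroupEmb))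
    (fun n f => by
      rw [OrderRingHom.comp_apply, OrderRingHom.comp_apply, compExpE_compat, ChainUnion.of_succ])

/-- The field `k((x^{-1}))^LE` of logarithmic-exponential series, the union of a chain of copies
`L_0 ⊆ L_1 ⊆ ⋯` of `k((x^{-1}))^E` in which the inclusion of `L_m` into `L_{m+1}` is given by
`Φ`. The element `f` of the copy `L_m` represents `f(log_m x)`. -/
abbrev LEField : Type u := ChainUnion (X := fun _ : ℕ => EField k) (fun _ => compExpE k)

variable {k} (expk : k → k)

/-- The exponential `∑ ε^i / i!` of an infinitesimal series. -/
def expSeries {Γ : Type u} [AddCommGroup Γ] [LinearOrder Γ] [IsOrderedAddMonoid Γ]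
    (ε : GenSeries k Γ) : GenSeries k Γ := subst (fun i => (i.factorial : k)⁻¹) ε

/-- The exponential `K_n → K_{n+1}`. Write `f = α + β + ε` where the monomials of `α` are larger
than `G_{n-1}`, the monomials of `β` are in `G_{n-1}`, and those of `ε` are smaller than `G_{n-1}`;
then `exp f = e(α) · exp β · ∑ ε^i / i!`, where `exp β` is given by the exponential of
`K_{n-1}` (of `k`, if `n = 0`). -/
def expStage : ∀ n, KE k n → KE k (n + 1)
  | 0, f =>
    monomial k (stageE k 0 ⟨part (larger (stage k 0).U) f, part_mem _ f⟩)
      * const (expk ((ofLex f).coeff 0))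
      * push (stageIncl k 0) (expSeries (part (smaller (stage k 0).U) f))
  | n + 1, f =>
    monomial k (stageE k (n + 1) ⟨part (larger (stage k (n + 1)).U) f, part_mem _ f⟩)
      * push (stageIncl k (n + 1)) (expStage n (pull (stageIncl k n) f))
      * push (stageIncl k (n + 1)) (expSeries (part (smaller (stage k (n + 1)).U) f))

/-- The exponential of `k((x^{-1}))^E`, the union of the exponentials `K_n → K_{n+1}`. -/
def EField.exp (a : EField k) : EField k :=
  let h := ChainUnion.exists_of _ a
  ChainUnion.of _ (h.choose + 1) (expStage expk h.choose h.choose_spec.choose)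

namespace LEField

/-- The exponential of `k((x^{-1}))^LE`, the union of the exponentials of the copies `L_m` of
`k((x^{-1}))^E`. -/
def exp (a : LEField k) : LEField k :=
  let h := ChainUnion.exists_of _ a
  ChainUnion.of _ h.choose (EField.exp expk h.choose_spec.choose)

variable (k)

/-- The element of `k((x^{-1}))^LE` given by an element of the `n`-th member `K_n` of the
`m`-th copy `L_m` of `k((x^{-1}))^E`. -/
def of (m n : ℕ) : KE k n →+*o LEField k :=
  (ChainUnion.of (X := fun _ : ℕ => EField k) (fun _ => compExpE k) m).comp
    (ChainUnion.of (X := KE k) (fun n => push (stageIncl k n)) n)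

/-- The subfield `L_m` of `k((x^{-1}))^LE`. -/
def L (m : ℕ) : Set (LEField k) := Set.range
  (ChainUnion.of (X := fun _ : ℕ => EField k) (fun _ => compExpE k) m)

/-- The composition with `exp x` on `k((x^{-1}))^LE`, which is `Φ` on each copy `L_m`. -/
def compExp : LEField k →+*o LEField k :=
  ChainUnion.map (fun _ => compExpE k) (fun _ _ => rfl)

/-- The constants `k ⊆ k((x^{-1}))^LE`. -/
def const (c : k) : LEField k := of k 0 0 (LESeries.const c)

/-- The series `x`. -/
def x : LEField k := of k 0 0 (monomial k (xPow k 1))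

end LEField

/-- The field of (grid-based) transseries of Écalle: the smallest subfield of `k((x^{-1}))^LE` which
contains `k` and `x`, is closed under the exponential and the logarithm, and is closed under
grid-based sums. The latter means: if a series `f` in some `K_n ⊆ L_m` has support in
`g₀ · g₁^ℕ ⋯ g_p^ℕ` for monomials `g₀, g₁, …, g_p` in the subfield with `g₁, …, g_p < 1`, then `f` is
in the subfield. -/
def transseries : Subfield (LEField k) :=
  sInf {F : Subfield (LEField k) |
    (∀ c, LEField.const k c ∈ F) ∧ LEField.x k ∈ F ∧
    (∀ a ∈ F, LEField.exp expk a ∈ F) ∧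
    (∀ a ∈ F, 0 < a → ∃ b ∈ F, LEField.exp expk b = a) ∧
    ∀ (m n : ℕ) (f : KE k n) (γ₀ : (stage k n).Γ) (s : Finset (stage k n).Γ),
      LEField.of k m n (monomial k γ₀) ∈ F →
      (∀ γ ∈ s, 0 < γ ∧ LEField.of k m n (monomial k γ) ∈ F) →
      (∀ γ ∈ supp f, ∃ δ ∈ AddSubmonoid.closure (s : Set (stage k n).Γ), γ = γ₀ + δ) →
      LEField.of k m n f ∈ F}

end LEField

/-- `φ` is an embedding of the ordered exponential field `(K, E)` into `(K', E')`. -/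
structure IsExpEmbedding {K K' : Type*} [Field K] [LinearOrder K] [Field K'] [LinearOrder K']
    (E : K → K) (E' : K' → K') (φ : K →+* K') : Prop where
  strictMono : StrictMono φ
  map_exp : ∀ a, φ (E a) = E' (φ a)

end LESeries

end

open LESeries

/-!
The proof rests on one construction. Call a *system of iterated logarithms* in a series field with
prelogarithmic section `l : G → k((G^{>1}))` a family of embeddings `r ↦ (log_m x)^r` of `k` into
`G` with `l ((log_m x)^r) = r log_{m+1} x` and `log_{m+1} x < log_m x` (`LogSystem`). Every such
system gives an embedding of `k((x^{-1}))^LE` into `k((G))^EL` which respects exponentials.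

On the `m`-th copy of `k((x^{-1}))^E` the embedding comes from maps `τ_n : G_n → G^{#n}` with
`τ_0 (x^r) = (log_m x)^r` and `τ_{n+1} (e(α) γ) = e(τ_n(α)) τ_n(γ)`. For `τ_{n+1}` to respect the
order, the factor `e(τ_n(α))` has to dominate: the series `τ_n(α)` has to be larger than all
`l^{#n}(τ_n(γ))`. So the induction carries the condition that the monomials of `l^{#n}(τ_n(γ))` are
smaller than `τ_n(δ)` for all `δ > G_{n-1}` (`StageEmb`, with induction step `StageEmb.next`). The
maps for `m + 1` and `m` differ by the substitution of `exp x` for `x`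
(`LogSystem.emb_compExpStage`), so that they fit together to a map on the union of the copies,
`LogSystem.embLE`.

That this map respects exponentials (`LogSystem.embLE_exp`) follows from the decomposition of
a series which defines the exponential of `K_n`, as `Exp` is a homomorphism with the right values
at purely infinite series, at constants and at infinitesimals. In particular it does not have to be
known beforehand that the exponential of `k((x^{-1}))^LE` is well defined on the union. Its
functional equation and its monotonicity are inherited from `Exp`. Surjectivity onto the positive
elements is reduced to monomials, where it holds because `log_m x` has the logarithm
`log_{m+1} x` (`LogSystem.isOrderedExp_LEField_exp`).

The field `k((G))^EL` itself is an ordered exponential field because its logarithm is a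
homomorphism, is positive at elements `> 1`, and is surjective: a series in `k((G^{#n}))` is the
prelogarithm of a series in `k((G^{#(n+1)}))` (`PrelogField.isOrderedExp_exp`). This uses the
identities between the exponential and the logarithmic power series at infinitesimal Hahn series
(`heval_heval`, `heval_expPS_add`).

The logarithmic words, their images under morphisms, and the Hahn groups all contain a system of
iterated logarithms. For the logarithmic words, the image of `τ_n` is `G_m^n`
(`LogSystem.chainPair_eq`), which identifies the image of the embedding with `LE(H, ψ)`.
-/

noncomputable section

namespace LESeries

/-! ### Evaluating power series at infinitesimal Hahn series -/

section Heval

variable {Γ k : Type*} [AddCommGroup Γ] [LinearOrder Γ] [IsOrderedAddMonoid Γ] [Field k]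

open HahnSeries SummableFamily

lemma orderTop_pos_iff {x : HahnSeries Γ k} : 0 < x.orderTop ↔ ∀ g ∈ x.support, 0 < g := by
  constructor
  · intro h g hg
    exact_mod_cast h.trans_le (orderTop_le_of_coeff_ne_zero hg)
  · intro h
    rcases eq_or_ne x 0 with rfl | hx
    · simp
    · rw [← order_eq_orderTop_of_ne_zero hx]
      exact_mod_cast h _ (by simpa [coeff_order_eq_zero] using hx)

/-- A given monomial occurs in only finitely many powers of an infinitesimal series. -/
lemma exists_forall_pow_coeff_eq_zero {x : HahnSeries Γ k} (hx : 0 < x.orderTop) (g : Γ) :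
    ∃ N, ∀ n, N ≤ n → (x ^ n).coeff g = 0 := by
  obtain ⟨N, hN⟩ := (pow_finite_co_support hx g).bddAbove
  refine ⟨N + 1, fun n hn => ?_⟩
  by_contra h
  have := hN (show n ∈ {a | (x ^ a).coeff g ≠ 0} from h)
  omega

lemma coeff_heval_eq_sum {x : HahnSeries Γ k} (hx : 0 < x.orderTop) (f : PowerSeries k) {g : Γ}
    {N : ℕ} (hN : ∀ n, N ≤ n → (x ^ n).coeff g = 0) :
    (PowerSeries.heval x f).coeff g
      = ∑ n ∈ Finset.range N, PowerSeries.coeff n f * (x ^ n).coeff g := by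
  rw [PowerSeries.coeff_heval]
  rw [finsum_eq_sum_of_support_subset (s := Finset.range N)]
  · simp [hx]
  · intro n hn
    by_contra h
    exact hn (by simp [hx, hN n (by simpa using h)])

lemma coeff_heval_eq_zero {x : HahnSeries Γ k} (hx : 0 < x.orderTop) {f : PowerSeries k} {g : Γ}
    {N : ℕ} (hN : ∀ n, N ≤ n → (x ^ n).coeff g = 0) (hf : PowerSeries.X ^ N ∣ f) :
    (PowerSeries.heval x f).coeff g = 0 := by
  rw [coeff_heval_eq_sum hx f hN]
  refine Finset.sum_eq_zero fun n hn => ?_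
  rw [PowerSeries.X_pow_dvd_iff.1 hf n (Finset.mem_range.1 hn), zero_mul]

lemma pow_coeff_eq_zero_of_nonpos {x : HahnSeries Γ k} (hx : 0 < x.orderTop) {g : Γ} (hg : g ≤ 0)
    {n : ℕ} (hn : 1 ≤ n) : (x ^ n).coeff g = 0 := by
  refine coeff_eq_zero_of_lt_orderTop ?_
  refine (lt_of_le_of_lt (b := (0 : WithTop Γ)) (by exact_mod_cast hg) ?_).trans_le
    orderTop_nsmul_le_orderTop_pow
  exact (nsmul_pos_iff (by omega)).mpr hx

lemma orderTop_heval_pos {x : HahnSeries Γ k} (hx : 0 < x.orderTop) {f : PowerSeries k}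
    (hf : PowerSeries.constantCoeff f = 0) : 0 < (PowerSeries.heval x f).orderTop := by
  rw [orderTop_pos_iff]
  intro g hg
  by_contra h
  refine hg (coeff_heval_eq_zero hx (N := 1)
    (fun n hn => pow_coeff_eq_zero_of_nonpos hx (not_lt.1 h) hn) ?_)
  rw [pow_one]
  exact PowerSeries.X_dvd_iff.2 hf

/-- Substitution of power series is compatible with evaluation at infinitesimal series. -/
lemma heval_heval {x : HahnSeries Γ k} (hx : 0 < x.orderTop) {p : PowerSeries k}
    (hp : PowerSeries.constantCoeff p = 0) (f : PowerSeries k) :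
    PowerSeries.heval (PowerSeries.heval x p) f = PowerSeries.heval x (f.subst p) := by
  have hp' : PowerSeries.HasSubst p := PowerSeries.HasSubst.of_constantCoeff_zero' hp
  have hpn : ∀ n, PowerSeries.X ^ n ∣ p ^ n := fun n =>
    pow_dvd_pow_of_dvd (PowerSeries.X_dvd_iff.2 hp) n
  ext g
  -- at the monomial `g` only the terms of degree `< N` matter, on both sides
  obtain ⟨N, hN⟩ := exists_forall_pow_coeff_eq_zero hx g
  have hN' : ∀ n, N ≤ n → ((PowerSeries.heval x p) ^ n).coeff g = 0 := by
    intro n hn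
    rw [← map_pow]
    exact coeff_heval_eq_zero hx hN ((pow_dvd_pow _ hn).trans (hpn n))
  rw [coeff_heval_eq_sum (orderTop_heval_pos hx hp) f hN']
  have key : PowerSeries.X ^ N ∣ f.subst p
      - ∑ n ∈ Finset.range N, PowerSeries.C (PowerSeries.coeff n f) * p ^ n := by
    rw [PowerSeries.X_pow_dvd_iff]
    intro i hi
    rw [map_sub, PowerSeries.coeff_subst' hp', map_sum, sub_eq_zero,
      finsum_eq_sum_of_support_subset (s := Finset.range N)]
    · exact Finset.sum_congr rfl fun n _ => by simp [PowerSeries.coeff_C_mul]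
    · intro n hn
      by_contra h
      refine hn ?_
      have : PowerSeries.coeff i (p ^ n) = 0 :=
        PowerSeries.X_pow_dvd_iff.1 (hpn n) i (by simp at h; omega)
      simp [this]
  have h0 := coeff_heval_eq_zero hx hN key
  rw [map_sub, coeff_sub, sub_eq_zero] at h0
  rw [h0, map_sum, coeff_sum]
  refine Finset.sum_congr rfl fun n _ => ?_
  rw [map_mul, PowerSeries.heval_C, map_pow, smul_mul_assoc, one_mul,
    HahnSeries.coeff_smul, smul_eq_mul]

/-- Reordering of a double sum by the sum of the indices. -/
lemma sum_sq_eq_sum_antidiagonal {M : Type*} [AddCommMonoid M] (F : ℕ → ℕ → M) (N : ℕ)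
    (hF : ∀ i j, N ≤ i ∨ N ≤ j → F i j = 0) :
    ∑ i ∈ Finset.range N, ∑ j ∈ Finset.range N, F i j
      = ∑ n ∈ Finset.range (2 * N), ∑ p ∈ Finset.HasAntidiagonal.antidiagonal n, F p.1 p.2 := by
  rw [← Finset.sum_product', Finset.sum_sigma']
  refine Finset.sum_of_injOn (fun p => ⟨p.1 + p.2, p⟩) ?_ ?_ ?_ ?_
  · rintro ⟨a, b⟩ _ ⟨c, d⟩ _ h
    simp only [Sigma.mk.injEq, heq_eq_eq] at h
    exact h.2
  · rintro ⟨a, b⟩ h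
    simp only [Finset.coe_product, Finset.coe_range, Set.mem_prod, Set.mem_Iio] at h
    simp only [Finset.coe_sigma, Set.mem_sigma_iff, Finset.mem_coe, Finset.mem_range,
      Finset.HasAntidiagonal.mem_antidiagonal, and_true]
    omega
  · rintro ⟨n, a, b⟩ h h'
    refine hF a b ?_
    by_contra! hc
    simp only [Finset.mem_sigma, Finset.mem_range, Finset.HasAntidiagonal.mem_antidiagonal] at h
    exact h' ⟨(a, b), by simp [hc.1, hc.2], by simp [h.2]⟩
  · intros; rfl

/-- The power series `∑ X^i / i!` over a field, in the form in which `expSeries` uses it. -/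
def expPS (k : Type*) [Field k] : PowerSeries k := PowerSeries.mk fun i => (i.factorial : k)⁻¹

/-- The power series of `log (1 + X)`, in the form in which `PrelogField.prelog` uses it. -/
def logPS (k : Type*) [Field k] : PowerSeries k := PowerSeries.mk fun i => (-1) ^ (i + 1) / (i : k)

lemma constantCoeff_logPS : PowerSeries.constantCoeff (logPS k) = 0 := by
  simp [← PowerSeries.coeff_zero_eq_constantCoeff_apply, logPS]

lemma constantCoeff_expPS : PowerSeries.constantCoeff (expPS k) = 1 := by
  simp [← PowerSeries.coeff_zero_eq_constantCoeff_apply, expPS]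

lemma constantCoeff_expPS_sub_one : PowerSeries.constantCoeff (expPS k - 1) = 0 := by
  simp [constantCoeff_expPS]

variable [CharZero k]

/-- The functional equation of the exponential series at infinitesimal Hahn series. -/
lemma heval_expPS_add {a b : HahnSeries Γ k} (ha : 0 < a.orderTop) (hb : 0 < b.orderTop) :
    PowerSeries.heval (a + b) (expPS k)
      = PowerSeries.heval a (expPS k) * PowerSeries.heval b (expPS k) := by
  have hab : 0 < (a + b).orderTop := lt_of_lt_of_le (lt_min ha hb) min_orderTop_le_orderTop_add
  ext g
  rw [PowerSeries.heval_apply a, PowerSeries.heval_apply b, ← hsum_mul,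
    coeff_hsum (s := (powerSeriesFamily a (expPS k)).mul (powerSeriesFamily b (expPS k)))]
  -- the double sum has only finitely many nonzero terms at the monomial `g`
  set S := (((powerSeriesFamily a (expPS k)).mul (powerSeriesFamily b (expPS k))).coeff g).support
    with hS
  obtain ⟨N0, hN0⟩ := exists_forall_pow_coeff_eq_zero hab g
  obtain ⟨N, hN1, hN⟩ : ∃ N, N0 ≤ 2 * N ∧ ∀ p ∈ S, p.1 < N ∧ p.2 < N := by
    refine ⟨N0 + S.sup (fun p => p.1 + p.2) + 1, by omega, fun p hp => ?_⟩
    have := Finset.le_sup (f := fun p : ℕ × ℕ => p.1 + p.2) hp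
    omega
  have hF : ∀ p : ℕ × ℕ, (((powerSeriesFamily a (expPS k)).mul
      (powerSeriesFamily b (expPS k))) p).coeff g
      = ((p.1.factorial : k)⁻¹ * (p.2.factorial : k)⁻¹) * (a ^ p.1 * b ^ p.2).coeff g := by
    intro p
    simp [ha, hb, expPS]
    ring
  have hF0 : ∀ i j, N ≤ i ∨ N ≤ j →
      ((i.factorial : k)⁻¹ * (j.factorial : k)⁻¹) * (a ^ i * b ^ j).coeff g = 0 := by
    intro i j h
    rw [← hF (i, j)]
    by_contra h'
    have := hN (i, j) (by rw [hS, Finsupp.mem_support_iff]; exact h')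
    simp only at this
    omega
  rw [finsum_eq_sum_of_support_subset (s := Finset.range N ×ˢ Finset.range N)]
  · simp only [hF]
    rw [Finset.sum_product,
      sum_sq_eq_sum_antidiagonal (fun i j => ((i.factorial : k)⁻¹ * (j.factorial : k)⁻¹)
        * (a ^ i * b ^ j).coeff g) N hF0,
      coeff_heval_eq_sum hab _ (N := 2 * N) (fun n hn => hN0 n (by omega))]
    refine Finset.sum_congr rfl fun n _ => ?_
    rw [(Commute.all a b).add_pow', coeff_sum, Finset.mul_sum]
    refine Finset.sum_congr rfl fun p hp => ?_
    have hp' := Finset.HasAntidiagonal.mem_antidiagonal.1 hp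
    rw [coeff_nsmul, Pi.smul_apply, nsmul_eq_mul, ← mul_assoc]
    congr 1
    have h3 := Nat.add_choose_mul_factorial_mul_factorial p.2 p.1
    rw [add_comm p.2, hp', mul_right_comm] at h3
    have h3' : ((n.choose p.1 : ℕ) : k) * (p.1.factorial : k) * (p.2.factorial : k)
        = (n.factorial : k) := by exact_mod_cast h3
    have f1 : (p.1.factorial : k) ≠ 0 := Nat.cast_ne_zero.2 (Nat.factorial_ne_zero _)
    have f2 : (p.2.factorial : k) ≠ 0 := Nat.cast_ne_zero.2 (Nat.factorial_ne_zero _)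
    have f3 : (n.factorial : k) ≠ 0 := Nat.cast_ne_zero.2 (Nat.factorial_ne_zero _)
    simp only [expPS, PowerSeries.coeff_mk]
    field_simp
    linear_combination h3'
  · rintro ⟨i, j⟩ hp
    have := hN (i, j) (by rw [hS, Finsupp.mem_support_iff]; exact hp)
    simpa using this

lemma expPS_eq : expPS k = PowerSeries.exp k := by
  ext n
  simp [expPS]

lemma logPS_eq : logPS k = PowerSeries.log k := by
  ext n
  rcases eq_or_ne n 0 with rfl | hn
  · simp [logPS]
  · simp [logPS, hn]

/-- `log (exp X) = X`: both sides have derivative `1` and no constant term. -/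
lemma logPS_subst_exp : (logPS k).subst (expPS k - 1) = PowerSeries.X := by
  have hs : PowerSeries.HasSubst (expPS k - 1) :=
    PowerSeries.HasSubst.of_constantCoeff_zero' constantCoeff_expPS_sub_one
  refine PowerSeries.derivative.ext ?_ ?_
  · rw [PowerSeries.derivative_subst hs, map_sub, expPS_eq, PowerSeries.derivative_exp,
      ← expPS_eq]
    have h1 : PowerSeries.derivative k (logPS k) * (1 + PowerSeries.X) = 1 := by
      rw [logPS_eq, PowerSeries.deriv_log]
      ext n
      rw [mul_add, mul_one]
      rcases n with _ | n
      · simp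
      · rw [map_add, PowerSeries.coeff_succ_mul_X]
        simp [pow_succ, PowerSeries.coeff_one]
    have h2 := congrArg (PowerSeries.subst (expPS k - 1)) h1
    rw [PowerSeries.subst_mul hs, PowerSeries.subst_add hs, PowerSeries.subst_X hs] at h2
    have h3 : PowerSeries.subst (expPS k - 1) (1 : PowerSeries k) = (1 : PowerSeries k) := by
      rw [← PowerSeries.coe_substAlgHom hs, map_one]
    rw [h3] at h2
    simpa using h2
  · rw [PowerSeries.constantCoeff_X]
    exact PowerSeries.constantCoeff_subst_eq_zero constantCoeff_expPS_sub_one _ constantCoeff_logPS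

/-- `exp (log (1 + X)) - 1 = X`, as a left inverse under substitution is the two-sided inverse. -/
lemma expPS_sub_one_subst_log : (expPS k - 1).subst (logPS k) = PowerSeries.X := by
  have h1 : IsUnit (PowerSeries.coeff 1 (expPS k - 1)) := by simp [expPS, PowerSeries.coeff_one]
  have hs : PowerSeries.HasSubst (expPS k - 1) :=
    PowerSeries.HasSubst.of_constantCoeff_zero' constantCoeff_expPS_sub_one
  have hr := PowerSeries.subst_substInvOfIsUnit_right (expPS k - 1)
    constantCoeff_expPS_sub_one h1
  have hi : PowerSeries.HasSubst ((expPS k - 1).substInvOfIsUnit h1) :=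
    PowerSeries.HasSubst.substInvOfIsUnit _ _
  have h2 : logPS k = (expPS k - 1).substInvOfIsUnit h1 := by
    have h3 := PowerSeries.subst_comp_subst_apply hs hi (logPS k)
    rw [logPS_subst_exp, PowerSeries.subst_X hi, hr, ← PowerSeries.map_algebraMap_eq_subst_X] at h3
    simpa using h3.symm
  rw [h2, hr]

end Heval

/-! ### Ordered fields of generalized power series -/

section Series

variable {Γ Γ' : Type u}
variable [AddCommGroup Γ] [LinearOrder Γ] [IsOrderedAddMonoid Γ]
variable [AddCommGroup Γ'] [LinearOrder Γ'] [IsOrderedAddMonoid Γ']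
variable {k : Type u} [Field k] [LinearOrder k]

lemma genSeries_ext {f g : GenSeries k Γ} (h : ∀ γ, (ofLex f).coeff γ = (ofLex g).coeff γ) :
    f = g :=
  ofLex.injective (HahnSeries.ext (funext h))

lemma coeff_add' (f g : GenSeries k Γ) (γ : Γ) :
    (ofLex (f + g)).coeff γ = (ofLex f).coeff γ + (ofLex g).coeff γ := rfl

lemma coeff_of_mem_seriesOn {S : Set Γ} {f : GenSeries k Γ} (hf : f ∈ seriesOn k S) {γ : Γ}
    (h : γ ∉ S) : (ofLex f).coeff γ = 0 := by
  by_contra h'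
  exact h (hf h')

lemma seriesOn_mono {S T : Set Γ} (h : S ⊆ T) : seriesOn k S ≤ seriesOn k T :=
  fun _ hf => Set.Subset.trans hf h

lemma const_mem (c : k) : const c ∈ seriesOn k ({0} : Set Γ) :=
  fun _ hγ => HahnSeries.support_single_subset hγ

variable (Γ) in
/-- The constants as a ring homomorphism. -/
def constHom : k →+* GenSeries k Γ := HahnSeries.C

lemma const_one : const (1 : k) = (1 : GenSeries k Γ) := map_one (constHom Γ)

lemma const_zero : const (0 : k) = (0 : GenSeries k Γ) := map_zero (constHom Γ)

lemma const_add (a b : k) : const (a + b) = (const a + const b : GenSeries k Γ) :=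
  map_add (constHom Γ) a b

lemma const_mul (a b : k) : const (a * b) = (const a * const b : GenSeries k Γ) :=
  map_mul (constHom Γ) a b

lemma const_ne_zero {c : k} (hc : c ≠ 0) : (const c : GenSeries k Γ) ≠ 0 :=
  (map_ne_zero (constHom Γ)).2 hc

lemma monomial_zero : monomial k (0 : Γ) = 1 := rfl

lemma monomial_add (γ δ : Γ) : monomial k (γ + δ) = monomial k γ * monomial k δ := by
  apply ofLex.injective
  change HahnSeries.single (γ + δ) (1 : k) = HahnSeries.single γ 1 * HahnSeries.single δ 1
  rw [HahnSeries.single_mul_single, one_mul]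

lemma monomial_ne_zero (γ : Γ) : monomial k γ ≠ 0 := by
  intro h
  have : HahnSeries.single γ (1 : k) = 0 := congrArg ofLex h
  simp at this

lemma monomial_mul_const (γ : Γ) (c : k) :
    monomial k γ * const c = toLex (HahnSeries.single γ c) := by
  apply ofLex.injective
  change HahnSeries.single γ (1 : k) * HahnSeries.single 0 c = HahnSeries.single γ c
  rw [HahnSeries.single_mul_single, one_mul, add_zero]

lemma const_strictMono : StrictMono (const : k → GenSeries k Γ) := by
  intro a b h
  refine (HahnSeries.lt_iff _ _).2 ⟨0, fun j hj => ?_, ?_⟩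
  · simp [const, HahnSeries.coeff_single_of_ne hj.ne]
  · simpa [const] using h

lemma monomial_pos [IsStrictOrderedRing k] (γ : Γ) : 0 < monomial k γ :=
  HahnSeries.leadingCoeff_pos_iff.1 (by simp [monomial])

lemma const_pos {c : k} (hc : 0 < c) : (0 : GenSeries k Γ) < const c := by
  rw [← const_zero]
  exact const_strictMono hc

/-- The sign of a sum is that of the summand with the larger monomials. -/
lemma pos_add_of_lt {S T : Set Γ} (hST : ∀ s ∈ S, ∀ t ∈ T, s < t) {f g : GenSeries k Γ}
    (hf : f ∈ seriesOn k S) (hg : g ∈ seriesOn k T) (h : 0 < f) : 0 < f + g := by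
  obtain ⟨i, hi, hi'⟩ := (HahnSeries.lt_iff _ _).1 h
  have hiS : i ∈ S := hf hi'.ne'
  have h0 : ∀ j ≤ i, (ofLex g).coeff j = 0 := fun j hj =>
    coeff_of_mem_seriesOn hg fun hT => absurd (hST i hiS j hT) (not_lt.2 hj)
  refine (HahnSeries.lt_iff _ _).2 ⟨i, fun j hj => ?_, ?_⟩
  · rw [coeff_add', h0 j hj.le, add_zero]
    exact hi j hj
  · rw [coeff_add', h0 i le_rfl, add_zero]
    exact hi'

/-- The infinitesimal series `k((G^{<1}))`: all monomials are `< 1`. -/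
abbrev infinitesimal (k Γ : Type u) [Field k] [LinearOrder k] [AddCommGroup Γ] [LinearOrder Γ] :
    AddSubgroup (GenSeries k Γ) := seriesOn k (Set.Ioi (0 : Γ))

lemma mem_infinitesimal_iff {f : GenSeries k Γ} :
    f ∈ infinitesimal k Γ ↔ 0 < (ofLex f).orderTop :=
  orderTop_pos_iff.symm

lemma mul_mem_infinitesimal {f g : GenSeries k Γ} (hf : f ∈ infinitesimal k Γ)
    (hg : g ∈ infinitesimal k Γ) : f * g ∈ infinitesimal k Γ := by
  rw [mem_infinitesimal_iff] at *
  refine lt_of_lt_of_le (hf.trans_le ?_) (HahnSeries.orderTop_add_le_mul (x := ofLex f)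
    (y := ofLex g))
  exact le_add_of_nonneg_right hg.le

lemma one_add_pos [IsStrictOrderedRing k] {f : GenSeries k Γ} (hf : f ∈ infinitesimal k Γ) :
    0 < 1 + f :=
  pos_add_of_lt (S := {0}) (fun _ hs _ ht => hs.trans_lt ht)
    (const_one (k := k) (Γ := Γ) ▸ const_mem 1) hf zero_lt_one

/-- The logarithm `∑ (-1)^(i-1) ε^i / i` of `1 + ε`. -/
def logSeries (ε : GenSeries k Γ) : GenSeries k Γ := subst (fun i => (-1) ^ (i + 1) / (i : k)) ε

lemma logSeries_eq (ε : GenSeries k Γ) :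
    logSeries ε = toLex (PowerSeries.heval (ofLex ε) (logPS k)) := rfl

lemma logSeries_mem {ε : GenSeries k Γ} (h : ε ∈ infinitesimal k Γ) :
    logSeries ε ∈ infinitesimal k Γ :=
  mem_infinitesimal_iff.2 (orderTop_heval_pos (mem_infinitesimal_iff.1 h) constantCoeff_logPS)

lemma expSeries_sub_one (ε : GenSeries k Γ) :
    expSeries ε - 1 = toLex (PowerSeries.heval (ofLex ε) (expPS k - 1)) := by
  rw [map_sub, map_one]
  rfl

lemma expSeries_sub_one_mem {ε : GenSeries k Γ} (h : ε ∈ infinitesimal k Γ) :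
    expSeries ε - 1 ∈ infinitesimal k Γ := by
  rw [expSeries_sub_one, mem_infinitesimal_iff]
  exact orderTop_heval_pos (mem_infinitesimal_iff.1 h) constantCoeff_expPS_sub_one

variable [IsStrictOrderedRing k]

lemma expSeries_pos {ε : GenSeries k Γ} (h : ε ∈ infinitesimal k Γ) : 0 < expSeries ε := by
  simpa using one_add_pos (expSeries_sub_one_mem h)

lemma expSeries_add {ε δ : GenSeries k Γ} (hε : ε ∈ infinitesimal k Γ)
    (hδ : δ ∈ infinitesimal k Γ) : expSeries (ε + δ) = expSeries ε * expSeries δ :=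
  congrArg toLex (heval_expPS_add (mem_infinitesimal_iff.1 hε) (mem_infinitesimal_iff.1 hδ))

lemma logSeries_expSeries {ε : GenSeries k Γ} (hε : ε ∈ infinitesimal k Γ) :
    logSeries (expSeries ε - 1) = ε := by
  have h := mem_infinitesimal_iff.1 hε
  rw [expSeries_sub_one, logSeries_eq, ofLex_toLex, heval_heval h constantCoeff_expPS_sub_one,
    logPS_subst_exp, PowerSeries.heval_X _ h]
  rfl

lemma expSeries_logSeries {ε : GenSeries k Γ} (hε : ε ∈ infinitesimal k Γ) :
    expSeries (logSeries ε) = 1 + ε := by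
  have h := mem_infinitesimal_iff.1 hε
  rw [← sub_eq_iff_eq_add', expSeries_sub_one, logSeries_eq, ofLex_toLex,
    heval_heval h constantCoeff_logPS, expPS_sub_one_subst_log, PowerSeries.heval_X _ h]
  rfl

/-- The functional equation `log ((1 + ε)(1 + δ)) = log (1 + ε) + log (1 + δ)`. -/
lemma logSeries_mul {ε δ : GenSeries k Γ} (hε : ε ∈ infinitesimal k Γ)
    (hδ : δ ∈ infinitesimal k Γ) :
    logSeries (ε + δ + ε * δ) = logSeries ε + logSeries δ := by
  have h : expSeries (logSeries ε + logSeries δ) - 1 = ε + δ + ε * δ := by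
    rw [expSeries_add (logSeries_mem hε) (logSeries_mem hδ), expSeries_logSeries hε,
      expSeries_logSeries hδ]
    ring
  rw [← h, logSeries_expSeries (add_mem (logSeries_mem hε) (logSeries_mem hδ))]

/-- `log (1 + ε)` is the product of `ε` and a series with leading term `1`. -/
lemma logSeries_pos {ε : GenSeries k Γ} (hε : ε ∈ infinitesimal k Γ) (h : 0 < ε) :
    0 < logSeries ε := by
  have h' := mem_infinitesimal_iff.1 hε
  obtain ⟨q, hq⟩ := PowerSeries.X_dvd_iff.2 (constantCoeff_logPS (k := k))
  have hq1 : PowerSeries.constantCoeff (q - 1) = 0 := by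
    have := congrArg (PowerSeries.coeff 1) hq
    rw [show (1 : ℕ) = 0 + 1 from rfl, PowerSeries.coeff_succ_X_mul] at this
    simp [logPS] at this
    simp [← this]
  have h1 : logSeries ε = ε * toLex (PowerSeries.heval (ofLex ε) q) := by
    rw [logSeries_eq, hq, map_mul, PowerSeries.heval_X _ h']
    rfl
  have h2 : toLex (PowerSeries.heval (ofLex ε) q)
      = 1 + toLex (PowerSeries.heval (ofLex ε) (q - 1)) := by
    rw [map_sub, map_one]
    exact (add_sub_cancel (1 : GenSeries k Γ) _).symm
  rw [h1, h2]
  exact mul_pos h (one_add_pos (mem_infinitesimal_iff.2 (orderTop_heval_pos h' hq1)))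

/-! ### Maps induced by embeddings of groups of monomials -/

lemma push_const (φ : OrderedGroupEmb Γ Γ') (c : k) : push φ (const c) = const c := by
  have h : φ.toFun 0 = 0 := map_zero φ.toAddMonoidHom
  refine (congrArg toLex (HahnSeries.embDomain_single
    (f := OrderEmbedding.ofStrictMono φ.toFun φ.strictMono) (g := (0 : Γ)) (r := c))).trans ?_
  exact congrArg (fun g => toLex (HahnSeries.single g c)) h

lemma coeff_push_of_notMem (φ : OrderedGroupEmb Γ Γ') (f : GenSeries k Γ) {γ : Γ'}
    (h : γ ∉ Set.range φ) : (ofLex (push φ f)).coeff γ = 0 := by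
  by_contra h'
  exact h (Set.image_subset_range _ _ (supp_push φ f h'))

lemma push_infinitesimal (φ : OrderedGroupEmb Γ Γ') {f : GenSeries k Γ}
    (hf : f ∈ infinitesimal k Γ) : push φ f ∈ infinitesimal k Γ' :=
  push_mem φ (fun γ (hγ : 0 < γ) =>
    (map_zero φ.toAddMonoidHom).symm.trans_lt (φ.strictMono hγ) :
      ∀ γ ∈ Set.Ioi (0 : Γ), φ γ ∈ Set.Ioi 0) hf

/-- The maps induced on series respect the infinite sums `∑ c_i ε^i`. -/
lemma push_subst (φ : OrderedGroupEmb Γ Γ') (c : ℕ → k) {ε : GenSeries k Γ}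
    (hε : ε ∈ infinitesimal k Γ) : push φ (subst c ε) = subst c (push φ ε) := by
  have h := mem_infinitesimal_iff.1 hε
  have h' := mem_infinitesimal_iff.1 (push_infinitesimal φ hε)
  have hp : ∀ n, (ofLex (push φ ε)) ^ n = ofLex (push φ (ε ^ n)) := fun n => by
    rw [map_pow]
    rfl
  refine push_ext φ _ _ (fun γ => ?_) (fun γ hγ => ?_)
  · obtain ⟨N, hN⟩ := exists_forall_pow_coeff_eq_zero h γ
    have hc : ∀ n, ((ofLex (push φ ε)) ^ n).coeff (φ γ) = ((ofLex ε) ^ n).coeff γ := fun n => by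
      rw [hp, push_coeff]
      rfl
    simp only [subst, ofLex_toLex]
    rw [coeff_heval_eq_sum h _ hN, coeff_heval_eq_sum h' (N := N)]
    · simp only [hc]
    · intro n hn
      rw [hc, hN n hn]
  · by_contra hr
    refine hγ ?_
    simp only [subst, ofLex_toLex]
    obtain ⟨N, hN⟩ := exists_forall_pow_coeff_eq_zero h' γ
    rw [coeff_heval_eq_sum h' _ hN]
    refine Finset.sum_eq_zero fun n _ => ?_
    rw [hp, coeff_push_of_notMem φ _ hr, mul_zero]

lemma push_expSeries (φ : OrderedGroupEmb Γ Γ') {ε : GenSeries k Γ}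
    (hε : ε ∈ infinitesimal k Γ) : push φ (expSeries ε) = expSeries (push φ ε) :=
  push_subst φ _ hε

lemma push_logSeries (φ : OrderedGroupEmb Γ Γ') {ε : GenSeries k Γ}
    (hε : ε ∈ infinitesimal k Γ) : push φ (logSeries ε) = logSeries (push φ ε) :=
  push_subst φ _ hε

lemma push_pull (φ : OrderedGroupEmb Γ Γ') {f : GenSeries k Γ'}
    (hf : f ∈ seriesOn k (Set.range φ)) : push φ (pull φ f) = f :=
  push_ext φ _ _ (fun _ => rfl) hf

lemma pull_mem (φ : OrderedGroupEmb Γ Γ') {S : Set Γ'} {T : Set Γ} {f : GenSeries k Γ'}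
    (hf : f ∈ seriesOn k S) (h : ∀ γ, φ γ ∈ S → γ ∈ T) : pull φ f ∈ seriesOn k T :=
  fun γ hγ => h γ (hf hγ)

/-- `k((φ(S))) = φ(k((S)))` -/
lemma mem_seriesOn_image_iff (φ : OrderedGroupEmb Γ Γ') {S : Set Γ} {f : GenSeries k Γ'} :
    f ∈ seriesOn k (φ '' S) ↔ ∃ g ∈ seriesOn k S, push φ g = f := by
  constructor
  · intro h
    refine ⟨pull φ f, pull_mem φ h ?_,
      push_pull φ fun γ hγ => Set.image_subset_range _ _ (h hγ)⟩
    rintro γ ⟨δ, hδ, e⟩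
    exact φ.strictMono.injective e ▸ hδ
  · rintro ⟨g, hg, rfl⟩
    exact push_mem φ (fun γ hγ => Set.mem_image_of_mem _ hγ) hg

/-! ### Multiplicative and additive decomposition of series -/

lemma coeff_part (S : Set Γ) (f : GenSeries k Γ) (γ : Γ) :
    (ofLex (part S f)).coeff γ = S.indicator (ofLex f).coeff γ := rfl

lemma coeff_const (c : k) (γ : Γ) :
    (ofLex (const c : GenSeries k Γ)).coeff γ = if γ = 0 then c else 0 := by
  split_ifs with h
  · subst h
    exact HahnSeries.coeff_single_same _ _
  · exact HahnSeries.coeff_single_of_ne h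

/-- Every series is the sum of a purely infinite series, a constant, and an infinitesimal. -/
lemma eq_part_add_const_add_part (f : GenSeries k Γ) :
    f = part (Set.Iio 0) f + const ((ofLex f).coeff 0) + part (Set.Ioi 0) f := by
  refine genSeries_ext fun γ => ?_
  rw [coeff_add', coeff_add', coeff_part, coeff_part, coeff_const]
  rcases lt_trichotomy γ 0 with h | rfl | h
  · simp [h, h.ne, h.not_gt]
  · simp
  · simp [h, h.ne', h.not_gt]

/-- The quotient of a nonzero series by its leading term is `1 + ε` with `ε` infinitesimal. -/
lemma leading_decomposition {f : GenSeries k Γ} (hf : f ≠ 0) :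
    f * (monomial k (ofLex f).order * const (ofLex f).leadingCoeff)⁻¹ - 1 ∈ infinitesimal k Γ := by
  have hf' : ofLex f ≠ 0 := hf
  have hl : (ofLex f).leadingCoeff ≠ 0 := HahnSeries.leadingCoeff_ne_zero.2 hf'
  have hm : HahnSeries.single (ofLex f).order (ofLex f).leadingCoeff ≠ 0 := by simpa using hl
  rw [monomial_mul_const, mem_infinitesimal_iff]
  set m := HahnSeries.single (ofLex f).order (ofLex f).leadingCoeff with hmdef
  change 0 < (ofLex f * m⁻¹ - 1).orderTop
  have h1 : ofLex f * m⁻¹ - 1 = (ofLex f - m) * m⁻¹ := by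
    rw [sub_mul, mul_inv_cancel₀ hm]
  have h2 : m⁻¹ = HahnSeries.single (-(ofLex f).order) ((ofLex f).leadingCoeff)⁻¹ :=
    HahnSeries.inv_single _ _
  rw [h1, orderTop_pos_iff]
  intro g hg
  rw [h2, HahnSeries.mem_support, HahnSeries.coeff_mul_single, sub_neg_eq_add] at hg
  by_contra hg0
  refine hg ?_
  rw [HahnSeries.coeff_sub]
  rcases (not_lt.1 hg0).lt_or_eq with h | rfl
  · have h3 : g + (ofLex f).order < (ofLex f).order := by simpa using h
    rw [HahnSeries.coeff_eq_zero_of_lt_order h3, hmdef, HahnSeries.coeff_single_of_ne h3.ne]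
    simp
  · rw [zero_add, hmdef, HahnSeries.coeff_single_same, HahnSeries.leadingCoeff_eq, sub_self,
      zero_mul]

end Series

/-! ### The logarithm of an EL-series field -/

section OrderedExp

variable {K : Type*} [Field K] [LinearOrder K] [IsStrictOrderedRing K] {E : K → K}

namespace IsOrderedExp

lemma pos (h : IsOrderedExp E) (a : K) : 0 < E a := by
  have : E a ∈ Set.range E := ⟨a, rfl⟩
  rwa [h.range_eq] at this

lemma map_zero (h : IsOrderedExp E) : E 0 = 1 := by
  have := h.map_add 0 0
  rw [add_zero] at this
  exact (mul_eq_left₀ (h.pos 0).ne').1 this.symm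

lemma log_exp (h : IsOrderedExp E) (a : K) : Function.invFun E (E a) = a :=
  Function.leftInverse_invFun h.strictMono.injective a

lemma exp_log (h : IsOrderedExp E) {a : K} (ha : 0 < a) : E (Function.invFun E a) = a := by
  have : a ∈ Set.range E := by rw [h.range_eq]; exact ha
  exact Function.invFun_eq this

lemma log_mul (h : IsOrderedExp E) {a b : K} (ha : 0 < a) (hb : 0 < b) :
    Function.invFun E (a * b) = Function.invFun E a + Function.invFun E b := by
  apply h.strictMono.injective
  rw [h.map_add, h.exp_log ha, h.exp_log hb, h.exp_log (mul_pos ha hb)]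

lemma log_one (h : IsOrderedExp E) : Function.invFun E 1 = 0 := by
  rw [← h.map_zero, h.log_exp]

lemma log_pos (h : IsOrderedExp E) {a : K} (ha : 1 < a) : 0 < Function.invFun E a := by
  rw [← h.strictMono.lt_iff_lt, h.map_zero, h.exp_log (zero_lt_one.trans ha)]
  exact ha

/-- A logarithm on the positive elements which is additive, positive at elements `> 1` and
surjective has an ordered exponential as its inverse. -/
lemma of_log {L : K → K} (hmul : ∀ a b, 0 < a → 0 < b → L (a * b) = L a + L b)
    (hpos : ∀ a, 1 < a → 0 < L a) (hsurj : ∀ b, ∃ a, 0 < a ∧ L a = b) :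
    IsOrderedExp (Function.invFunOn L (Set.Ioi 0)) := by
  have hmono : ∀ a b, 0 < a → a < b → L a < L b := by
    intro a b ha hab
    have h1 : 1 < b / a := (one_lt_div ha).2 hab
    have h2 := hmul a (b / a) ha (zero_lt_one.trans h1)
    rw [mul_div_cancel₀ b ha.ne'] at h2
    rw [h2]
    exact lt_add_of_pos_right _ (hpos _ h1)
  have hinj : ∀ a b, 0 < a → 0 < b → L a = L b → a = b := by
    intro a b ha hb h
    rcases lt_trichotomy a b with h' | h' | h'
    · exact absurd h (hmono a b ha h').ne
    · exact h'
    · exact absurd h (hmono b a hb h').ne'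
  have hE : ∀ b, 0 < Function.invFunOn L (Set.Ioi 0) b ∧
      L (Function.invFunOn L (Set.Ioi 0) b) = b :=
    fun b => by
      obtain ⟨a, ha, hab⟩ := hsurj b
      have h : ∃ a ∈ Set.Ioi (0 : K), L a = b := ⟨a, ha, hab⟩
      exact ⟨Function.invFunOn_mem h, Function.invFunOn_eq h⟩
  refine ⟨fun a b hab => ?_, fun a b => ?_, ?_⟩
  · by_contra h
    rcases (not_lt.1 h).lt_or_eq with h | h
    · have := hmono _ _ (hE b).1 h
      rw [(hE a).2, (hE b).2] at this
      exact this.not_gt hab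
    · have := congrArg L h
      rw [(hE a).2, (hE b).2] at this
      exact hab.ne' this
  · refine hinj _ _ (hE _).1 (mul_pos (hE _).1 (hE _).1) ?_
    rw [hmul _ _ (hE a).1 (hE b).1, (hE _).2, (hE a).2, (hE b).2]
  · refine Set.Subset.antisymm ?_ fun a ha => ⟨L a, hinj _ _ (hE _).1 ha (hE _).2⟩
    rintro _ ⟨b, rfl⟩
    exact (hE b).1

end IsOrderedExp

end OrderedExp

namespace ChainUnion

variable {X : ℕ → Type u} [∀ n, Field (X n)] [∀ n, LinearOrder (X n)] {f : ∀ n, X n →+*o X (n + 1)}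

lemma of_injective (n : ℕ) : Function.Injective (of f n) :=
  (of f n : X n →+* ChainUnion f).injective

lemma of_strictMono (n : ℕ) : StrictMono (of f n) :=
  (of f n).monotone'.strictMono_of_injective (of_injective n)

lemma of_pos_iff {n : ℕ} {x : X n} : 0 < of f n x ↔ 0 < x := by
  rw [← map_zero (of f n), (of_strictMono n).lt_iff_lt]

lemma of_transition {m n : ℕ} (h : m ≤ n) (x : X m) :
    of f n (transition f m n h x) = of f m x := by
  induction n, h using Nat.le_induction with
  | base => simp [transition_self]
  | succ n hn ih =>
    rw [transition_succ f m n hn]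
    exact (of_succ f n _).trans ih

/-- Every element of the union is given by an element of the `n`-th member for all large `n`. -/
lemma exists_of_ge (a : ChainUnion f) : ∃ m, ∀ n, m ≤ n → ∃ x, of f n x = a := by
  obtain ⟨m, x, rfl⟩ := exists_of f a
  exact ⟨m, fun n h => ⟨_, of_transition h x⟩⟩

lemma exists_of₂ (a b : ChainUnion f) : ∃ n x y, of f n x = a ∧ of f n y = b := by
  obtain ⟨m, hm⟩ := exists_of_ge a
  obtain ⟨m', hm'⟩ := exists_of_ge b
  obtain ⟨x, hx⟩ := hm _ (le_max_left m m')
  obtain ⟨y, hy⟩ := hm' _ (le_max_right m m')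
  exact ⟨_, x, y, hx, hy⟩

/-- Partial functions on the members of a chain which are compatible with the inclusions have a
common value at all representatives of an element of the union. -/
lemma eq_of_of_eq {Z : Type*} (p : ∀ n, X n → Prop) (F : ∀ n, X n → Z)
    (hp : ∀ n x, p n x → p (n + 1) (f n x)) (hF : ∀ n x, p n x → F (n + 1) (f n x) = F n x)
    {m n : ℕ} {x : X m} {y : X n} (hx : p m x) (hy : p n y) (h : of f m x = of f n y) :
    F m x = F n y := by
  have key : ∀ (m n : ℕ) (h : m ≤ n) (x : X m), p m x →
      p n (transition f m n h x) ∧ F n (transition f m n h x) = F m x := by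
    intro m n h x hx
    induction n, h using Nat.le_induction with
    | base => simp [transition_self, hx]
    | succ n hn ih =>
      rw [transition_succ f m n hn, RingHom.comp_apply]
      exact ⟨hp n _ ih.1, (hF n _ ih.1).trans ih.2⟩
  rw [← (key m (max m n) (le_max_left _ _) x hx).2, ← (key n (max m n) (le_max_right _ _) y hy).2]
  congr 1
  apply of_injective (f := f)
  rw [of_transition, of_transition, h]

end ChainUnion

namespace PrelogField

variable {k : Type u} [Field k] [LinearOrder k] [IsStrictOrderedRing k]

/-- The inclusion of `k((G))` into its exponential extension as a morphism. -/
def inclHom (P : PrelogField k) : Hom P P.ext where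
  toOrderedGroupEmb := P.incl
  comm _ := rfl

/-- The formal exponential `e(α)` as a monomial of `k((G^#))`. -/
def extE (P : PrelogField k) (α : purelyInf k P.Γ) : P.ext.Γ := ExpCopy.e α

lemma ext_l_extE (P : PrelogField k) (α : purelyInf k P.Γ) :
    (P.ext.l (P.extE α)).1 = push P.inclHom.toOrderedGroupEmb α.1 := rfl

/-- Every positive series is of the form `g a (1 + ε)` with `g` a monomial, `a` a positive constant
and `ε` infinitesimal. -/
lemma exists_decomposition {Γ : Type u} [AddCommGroup Γ] [LinearOrder Γ] [IsOrderedAddMonoid Γ]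
    {f : GenSeries k Γ} (hf : 0 < f) :
    ∃ γ a ε, 0 < a ∧ ε ∈ infinitesimal k Γ ∧ f = monomial k γ * const a * (1 + ε) := by
  have ha : 0 < (ofLex f).leadingCoeff := HahnSeries.leadingCoeff_pos_iff.2 hf
  refine ⟨(ofLex f).order, (ofLex f).leadingCoeff, _, ha, leading_decomposition hf.ne', ?_⟩
  rw [add_sub_cancel, mul_comm f, mul_inv_cancel_left₀]
  exact mul_ne_zero (monomial_ne_zero _) (const_ne_zero ha.ne')

variable {expk : k → k} (hexp : IsOrderedExp expk)

/-- The formula which defines the prelogarithm. -/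
lemma prelog_eq (P : PrelogField k) (γ : P.Γ) {a : k} (ha : 0 < a) {ε : GenSeries k P.Γ}
    (hε : ε ∈ infinitesimal k P.Γ) :
    P.prelog expk (monomial k γ * const a * (1 + ε))
      = (P.l γ).1 + const (Function.invFun expk a) + logSeries ε := by
  have hm : HahnSeries.single γ a ≠ 0 := by simpa using ha.ne'
  have hm' : (monomial k γ * const a : GenSeries k P.Γ) ≠ 0 := by
    rw [monomial_mul_const]
    exact hm
  have h1 : ofLex (1 + ε) ≠ 0 := (one_add_pos hε).ne'
  have h10 : (ofLex (1 + ε)).coeff 0 = 1 := by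
    rw [coeff_add', coeff_of_mem_seriesOn hε (lt_irrefl _), add_zero]
    exact HahnSeries.coeff_one.trans (if_pos rfl)
  have ho : (ofLex (1 + ε)).order = 0 := by
    refine le_antisymm (HahnSeries.order_le_of_coeff_ne_zero (by rw [h10]; exact one_ne_zero)) ?_
    rw [HahnSeries.le_order_iff_forall h1]
    intro j hj
    rw [coeff_add', coeff_of_mem_seriesOn hε (not_lt.2 hj.le), add_zero]
    exact HahnSeries.coeff_one.trans (if_neg hj.ne)
  have e1 : ofLex (monomial k γ * const a * (1 + ε)) = HahnSeries.single γ a * ofLex (1 + ε) := by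
    rw [monomial_mul_const]
    rfl
  have e2 : (ofLex (monomial k γ * const a * (1 + ε))).order = γ := by
    rw [e1, HahnSeries.order_mul hm h1, HahnSeries.order_single ha.ne', ho, add_zero]
  have e3 : (ofLex (monomial k γ * const a * (1 + ε))).leadingCoeff = a := by
    rw [e1, HahnSeries.leadingCoeff_mul, HahnSeries.leadingCoeff_of_single,
      HahnSeries.leadingCoeff_eq (x := ofLex (1 + ε)), ho, h10, mul_one]
  simp only [prelog]
  rw [e2, e3, mul_comm (monomial k γ * const a), mul_inv_cancel_right₀ hm', add_sub_cancel_left]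
  rfl

/-- Morphisms respect the prelogarithms. -/
lemma prelog_push {P Q : PrelogField k} (ψ : Hom P Q) {f : GenSeries k P.Γ} (hf : 0 < f) :
    push ψ.toOrderedGroupEmb (P.prelog expk f) = Q.prelog expk (push ψ.toOrderedGroupEmb f) := by
  obtain ⟨γ, a, ε, ha, hε, rfl⟩ := exists_decomposition hf
  rw [prelog_eq P γ ha hε, map_mul, map_mul, map_add, map_add, map_add, push_monomial, push_const,
    push_const, map_one, push_logSeries _ hε, prelog_eq Q _ ha (push_infinitesimal _ hε), ψ.comm]

include hexp

lemma prelog_mul (P : PrelogField k) {f g : GenSeries k P.Γ} (hf : 0 < f) (hg : 0 < g) :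
    P.prelog expk (f * g) = P.prelog expk f + P.prelog expk g := by
  obtain ⟨γ, a, ε, ha, hε, rfl⟩ := exists_decomposition hf
  obtain ⟨δ, b, η, hb, hη, rfl⟩ := exists_decomposition hg
  have h : monomial k γ * const a * (1 + ε) * (monomial k δ * const b * (1 + η))
      = monomial k (γ + δ) * const (a * b) * (1 + (ε + η + ε * η)) := by
    rw [monomial_add, const_mul]
    ring
  rw [h, prelog_eq P _ ha hε, prelog_eq P _ hb hη, prelog_eq P _ (mul_pos ha hb)
    (add_mem (add_mem hε hη) (mul_mem_infinitesimal hε hη)), map_add, logSeries_mul hε hη,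
    hexp.log_mul ha hb, const_add, AddSubgroup.coe_add]
  ring

lemma prelog_pos (P : PrelogField k) {f : GenSeries k P.Γ} (hf : 1 < f) :
    0 < P.prelog expk f := by
  obtain ⟨γ, a, ε, ha, hε, rfl⟩ := exists_decomposition (zero_lt_one.trans hf)
  rw [prelog_eq P γ ha hε]
  rcases lt_trichotomy γ 0 with hγ | rfl | hγ
  · rw [add_assoc]
    refine pos_add_of_lt (S := Set.Iio 0) (T := Set.Ici 0) (fun s hs t ht => lt_of_lt_of_le hs ht)
      (P.l γ).2 (add_mem (seriesOn_mono ?_ (const_mem _)) (seriesOn_mono ?_ (logSeries_mem hε))) ?_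
    · rintro _ rfl
      exact le_refl (0 : P.Γ)
    · exact fun _ h => le_of_lt h
    · have := P.l_strictAnti hγ
      rw [map_zero] at this
      exact this
  · rw [map_zero, AddSubgroup.coe_zero, zero_add]
    rw [monomial_zero, one_mul] at hf
    rcases lt_trichotomy a 1 with h1 | rfl | h1
    · exfalso
      have h2 : 0 < const (1 - a) + -(const a * ε) := by
        refine pos_add_of_lt (S := {0}) (T := Set.Ioi 0) (fun s hs t ht => hs.trans_lt ht)
          (const_mem _) (neg_mem ?_) ?_
        · rw [mem_infinitesimal_iff] at hε ⊢
          refine lt_of_lt_of_le (hε.trans_le ?_) (HahnSeries.orderTop_add_le_mul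
            (x := ofLex (const a)) (y := ofLex ε))
          refine le_add_of_nonneg_left ?_
          have : (ofLex (const a : GenSeries k P.Γ)).orderTop = 0 :=
            HahnSeries.orderTop_single ha.ne'
          rw [this]
        · rw [← const_zero]
          exact const_strictMono (sub_pos.2 h1)
      have h3 : (const (1 - a) : GenSeries k P.Γ) = 1 - const a := map_sub (constHom P.Γ) 1 a
      rw [h3] at h2
      have h4 : (1 : GenSeries k P.Γ) - const a + -(const a * ε) = 1 - const a * (1 + ε) := by ring
      rw [h4, sub_pos] at h2
      exact h2.not_gt hf
    · rw [hexp.log_one, const_zero, zero_add]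
      rw [const_one, one_mul] at hf
      exact logSeries_pos hε (by simpa using hf)
    · refine pos_add_of_lt (S := {0}) (T := Set.Ioi 0) (fun s hs t ht => hs.trans_lt ht)
        (const_mem _) (logSeries_mem hε) ?_
      rw [← const_zero]
      exact const_strictMono (hexp.log_pos h1)
  · exfalso
    have hinf : -(monomial k γ * const a * (1 + ε)) ∈ infinitesimal k P.Γ := by
      refine neg_mem ?_
      have e : (monomial k γ * const a : GenSeries k P.Γ) ∈ infinitesimal k P.Γ := by
        rw [monomial_mul_const]
        intro δ hδ
        rw [show δ = γ from HahnSeries.support_single_subset hδ]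
        exact hγ
      rw [mul_add, mul_one]
      exact add_mem e (mul_mem_infinitesimal e hε)
    have := one_add_pos hinf
    rw [← sub_eq_add_neg, sub_pos] at this
    exact this.not_gt hf

/-- Every series in `k((G))` is the prelogarithm of a positive series in `k((G^#))`. -/
lemma exists_prelog_ext_eq (P : PrelogField k) (f : GenSeries k P.Γ) :
    ∃ g : GenSeries k P.ext.Γ, 0 < g ∧
      P.ext.prelog expk g = push P.inclHom.toOrderedGroupEmb f := by
  have hε : push P.inclHom.toOrderedGroupEmb (part (Set.Ioi 0) f) ∈ infinitesimal k P.ext.Γ :=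
    push_infinitesimal _ (part_mem _ f)
  have h1 := expSeries_sub_one_mem hε
  have hpos := hexp.pos ((ofLex f).coeff 0)
  refine ⟨monomial k (P.extE ⟨part (Set.Iio 0) f, part_mem _ f⟩)
    * const (expk ((ofLex f).coeff 0)) * (1 + (expSeries _ - 1)),
    mul_pos (mul_pos (monomial_pos _) (const_pos hpos)) (one_add_pos h1), ?_⟩
  rw [prelog_eq _ _ hpos h1, hexp.log_exp, logSeries_expSeries hε, ext_l_extE]
  conv_rhs => rw [eq_part_add_const_add_part f, map_add, map_add, push_const]

omit hexp

/-- The inclusion of `k((G^{#n}))` into `k((G))^EL`. -/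
def elOf (P : PrelogField k) (n : ℕ) : GenSeries k (P.iter n).Γ →+*o P.EL :=
  ChainUnion.of (X := fun n => GenSeries k (P.iter n).Γ) (fun n => push (P.inclIter n)) n

section elOf

variable (P : PrelogField k)

lemma elOf_strictMono (n : ℕ) : StrictMono (elOf P n) := ChainUnion.of_strictMono n

lemma elOf_pos_iff {n : ℕ} {f : GenSeries k (P.iter n).Γ} : 0 < elOf P n f ↔ 0 < f :=
  ChainUnion.of_pos_iff

lemma exists_elOf (a : P.EL) : ∃ n f, elOf P n f = a := ChainUnion.exists_of _ a

lemma exists_elOf₂ (a b : P.EL) : ∃ n f g, elOf P n f = a ∧ elOf P n g = b :=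
  ChainUnion.exists_of₂ a b

lemma elOf_succ (n : ℕ) (f : GenSeries k (P.iter n).Γ) :
    elOf P (n + 1) (push (P.inclIter n) f) = elOf P n f :=
  ChainUnion.of_succ (X := fun n => GenSeries k (P.iter n).Γ) (fun n => push (P.inclIter n)) n f

end elOf

/-- The logarithm of the union can be computed in any member of the chain. -/
lemma log_elOf (P : PrelogField k) (n : ℕ) {f : GenSeries k (P.iter n).Γ} (hf : 0 < f) :
    EL.log expk P (elOf P n f) = elOf P n ((P.iter n).prelog expk f) := by
  have h := exists_elOf P (elOf P n f)
  refine ChainUnion.eq_of_of_eq (X := fun n => GenSeries k (P.iter n).Γ)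
    (f := fun n => push (P.inclIter n)) (fun n f => 0 < f)
    (fun n f => elOf P n ((P.iter n).prelog expk f)) ?_ ?_ ?_ hf h.choose_spec.choose_spec
  · intro n f hf
    rw [← map_zero (push (P.inclIter n))]
    exact push_strictMono (P.inclIter n) hf
  · intro n f hf
    rw [← elOf_succ P n (prelog expk (P.iter n) f)]
    exact congrArg (elOf P (n + 1)) (prelog_push (expk := expk) (P.iter n).inclHom hf).symm
  · have h' := h.choose_spec.choose_spec
    have h0 := (elOf_pos_iff P).2 hf
    rw [← h'] at h0
    exact (elOf_pos_iff P).1 h0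

include hexp

lemma exists_log_eq (P : PrelogField k) (b : P.EL) : ∃ a, 0 < a ∧ EL.log expk P a = b := by
  obtain ⟨n, f, rfl⟩ := exists_elOf P b
  obtain ⟨g, hg, h⟩ := exists_prelog_ext_eq hexp (P.iter n) f
  refine ⟨elOf P (n + 1) g, (elOf_pos_iff P (n := n + 1)).2 hg, ?_⟩
  refine (log_elOf P (n + 1) hg).trans ?_
  exact (congrArg (elOf P (n + 1)) h).trans (elOf_succ P n f)

/-- The field `k((G))^EL` is an ordered exponential field. -/
theorem isOrderedExp_exp (P : PrelogField k) : IsOrderedExp (EL.exp expk P) := by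
  refine IsOrderedExp.of_log ?_ ?_ (exists_log_eq hexp P)
  · intro a b ha hb
    obtain ⟨n, f, g, rfl, rfl⟩ := exists_elOf₂ P a b
    rw [elOf_pos_iff] at ha hb
    rw [← map_mul, log_elOf P n ha, log_elOf P n hb, log_elOf P n (mul_pos ha hb),
      prelog_mul hexp _ ha hb, map_add]
  · intro a ha
    obtain ⟨n, f, rfl⟩ := exists_elOf P a
    rw [← map_one (elOf P n), (elOf_strictMono P n).lt_iff_lt] at ha
    rw [log_elOf P n (zero_lt_one.trans ha), elOf_pos_iff]
    exact prelog_pos hexp _ ha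

theorem log_exp (P : PrelogField k) (a : P.EL) : EL.log expk P (EL.exp expk P a) = a :=
  Function.invFunOn_eq (exists_log_eq hexp P a)

lemma exp_log (P : PrelogField k) {a : P.EL} (ha : 0 < a) :
    EL.exp expk P (EL.log expk P a) = a := by
  have ha' : a ∈ Set.range (EL.exp expk P) := by
    rw [(isOrderedExp_exp hexp P).range_eq]
    exact ha
  obtain ⟨b, rfl⟩ := ha'
  rw [log_exp hexp P]

lemma exp_elOf_of_prelog_eq (P : PrelogField k) (n : ℕ) {f g : GenSeries k (P.iter n).Γ}
    (hf : 0 < f) (h : (P.iter n).prelog expk f = g) :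
    EL.exp expk P (elOf P n g) = elOf P n f := by
  rw [← h, ← log_elOf P n hf, exp_log hexp P ((elOf_pos_iff P).2 hf)]

/-- The prelogarithm of a product of a monomial and a constant. -/
lemma prelog_monomial_mul_const (P : PrelogField k) (γ : P.Γ) {a : k} (ha : 0 < a) :
    P.prelog expk (monomial k γ * const a)
      = (P.l γ).1 + const (Function.invFun expk a) := by
  have hz : (0 : GenSeries k P.Γ) ∈ infinitesimal k P.Γ := zero_mem _
  have h3 := expSeries_add hz hz
  rw [add_zero] at h3
  have h0 := logSeries_expSeries hz
  rw [(mul_eq_left₀ (expSeries_pos hz).ne').1 h3.symm, sub_self] at h0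
  have := prelog_eq (expk := expk) P γ ha hz
  rwa [h0, add_zero, add_zero, mul_one] at this

/-- `Exp α = e(α)` for purely infinite `α`. -/
lemma exp_elOf_purelyInf (P : PrelogField k) (n : ℕ) (α : purelyInf k (P.iter n).Γ) :
    EL.exp expk P (elOf P n α.1) = elOf P (n + 1) (monomial k ((P.iter n).extE α)) := by
  rw [← elOf_succ P n]
  refine exp_elOf_of_prelog_eq hexp P (n + 1) (monomial_pos _) ?_
  have h := prelog_monomial_mul_const hexp (P.iter n).ext ((P.iter n).extE α) one_pos
  rw [const_one, mul_one, hexp.log_one, const_zero, add_zero, ext_l_extE] at h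
  exact h

lemma exp_elOf_infinitesimal (P : PrelogField k) (n : ℕ) {ε : GenSeries k (P.iter n).Γ}
    (hε : ε ∈ infinitesimal k _) :
    EL.exp expk P (elOf P n ε) = elOf P n (expSeries ε) := by
  refine exp_elOf_of_prelog_eq hexp P n (expSeries_pos hε) ?_
  have h1 : expSeries ε = monomial k 0 * const 1 * (1 + (expSeries ε - 1)) := by
    rw [const_one, monomial_zero]
    ring
  rw [h1, prelog_eq _ _ one_pos (expSeries_sub_one_mem hε),
    hexp.log_one, const_zero, map_zero, AddSubgroup.coe_zero, zero_add, zero_add,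
    logSeries_expSeries hε]

lemma exp_elOf_const (P : PrelogField k) (n : ℕ) (c : k) :
    EL.exp expk P (elOf P n (const c)) = elOf P n (const (expk c)) := by
  refine exp_elOf_of_prelog_eq hexp P n (const_pos (hexp.pos c)) ?_
  have h := prelog_monomial_mul_const hexp (P.iter n) 0 (hexp.pos c)
  rwa [monomial_zero, one_mul, hexp.log_exp, map_zero, AddSubgroup.coe_zero, zero_add] at h

end PrelogField

variable {k : Type u} [Field k] [LinearOrder k] [IsStrictOrderedRing k]

/-! ### Embedding the groups `G_n` into exponential extensions -/

lemma OrderedGroupEmb.apply_zero {Γ Γ' : Type u} [AddCommGroup Γ] [LinearOrder Γ]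
    [IsOrderedAddMonoid Γ] [AddCommGroup Γ'] [LinearOrder Γ'] [IsOrderedAddMonoid Γ']
    (φ : OrderedGroupEmb Γ Γ') : φ 0 = 0 := map_zero φ.toAddMonoidHom

lemma OrderedGroupEmb.apply_add {Γ Γ' : Type u} [AddCommGroup Γ] [LinearOrder Γ]
    [IsOrderedAddMonoid Γ] [AddCommGroup Γ'] [LinearOrder Γ'] [IsOrderedAddMonoid Γ']
    (φ : OrderedGroupEmb Γ Γ') (γ δ : Γ) : φ (γ + δ) = φ γ + φ δ := map_add φ.toAddMonoidHom γ δ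

/-- If `ψ ∘ φ = χ` on exponents then the same holds for the induced maps on series. -/
lemma push_comp {Γ Γ' Γ'' : Type u} [AddCommGroup Γ] [LinearOrder Γ] [IsOrderedAddMonoid Γ]
    [AddCommGroup Γ'] [LinearOrder Γ'] [IsOrderedAddMonoid Γ'] [AddCommGroup Γ''] [LinearOrder Γ'']
    [IsOrderedAddMonoid Γ''] (φ : OrderedGroupEmb Γ Γ') (ψ : OrderedGroupEmb Γ' Γ'')
    (χ : OrderedGroupEmb Γ Γ'') (h : ∀ γ, ψ (φ γ) = χ γ) (f : GenSeries k Γ) :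
    push ψ (push φ f) = push χ f := by
  rw [push_push φ ψ { toAddMonoidHom := AddMonoidHom.id Γ, strictMono := strictMono_id } χ h]
  congr 1
  exact push_ext _ _ _ (fun _ => rfl) fun γ _ => ⟨γ, rfl⟩

namespace PrelogField

/-- The exponent `α` of a monomial `e(α)` of `k((G^#))`. -/
def extLog (P : PrelogField k) : P.ext.Γ →+ GenSeries k P.Γ := ExpCopy.logHom k (Set.Iio 0)

variable (P : PrelogField k)

lemma extLog_lt_extLog {g h : P.ext.Γ} : P.extLog g < P.extLog h ↔ h < g := Iff.rfl

lemma extLog_injective : Function.Injective P.extLog := ExpCopy.log_injective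

lemma extLog_extE (α : purelyInf k P.Γ) : P.extLog (P.extE α) = α.1 := rfl

lemma extLog_inclHom (γ : P.Γ) : P.extLog (P.inclHom.toOrderedGroupEmb γ) = (P.l γ).1 := rfl

lemma ext_l_eq (g : P.ext.Γ) :
    (P.ext.l g).1 = push P.inclHom.toOrderedGroupEmb (P.extLog g) := rfl

lemma extLog_mem (g : P.ext.Γ) : P.extLog g ∈ purelyInf k P.Γ := ExpCopy.log_mem g

end PrelogField

lemma larger_subset_Iio {Γ : Type u} [AddCommGroup Γ] [LinearOrder Γ] (U : AddSubgroup Γ) :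
    larger U ⊆ Set.Iio 0 := fun _ h => h 0 (zero_mem U)

lemma smaller_subset_Ioi {Γ : Type u} [AddCommGroup Γ] [LinearOrder Γ] (U : AddSubgroup Γ) :
    smaller U ⊆ Set.Ioi 0 := fun _ h => h 0 (zero_mem U)

/-- An embedding `τ` of the group of a stage `(G, U)` into the monomials of a prelogarithmic field
such that the logarithms of the monomials in `τ(G)` only have monomials which are smaller than all
`τ(g)` with `g > U`. This makes `e(α) γ ↦ e(τ(α)) τ(γ)` an embedding of ordered groups. -/
structure StageEmb (S : EStage k) (P : PrelogField k) extends OrderedGroupEmb S.Γ P.Γ where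
  dominates : ∀ γ, ∀ ε ∈ supp (P.l (toFun γ)).1, ∀ δ ∈ larger S.U, toFun δ < ε

namespace StageEmb

open PrelogField

variable {S : EStage k} {P : PrelogField k} (τ : StageEmb S P)

lemma push_mem_purelyInf (α : seriesOn k (larger S.U)) :
    push τ.toOrderedGroupEmb α.1 ∈ purelyInf k P.Γ :=
  push_purelyInf _ (seriesOn_mono (larger_subset_Iio _) α.2)

/-- The map `e(α) γ ↦ e(τ(α)) τ(γ)` on monomials. -/
def nextFun (p : S.next.Γ) : P.ext.Γ :=
  P.extE ⟨push τ.toOrderedGroupEmb (ExpCopy.log (ofLex p).1),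
    τ.push_mem_purelyInf ⟨_, ExpCopy.log_mem _⟩⟩
  + P.inclHom.toOrderedGroupEmb (τ.toOrderedGroupEmb (ofLex p).2)

lemma extLog_nextFun (p : S.next.Γ) :
    P.extLog (τ.nextFun p) = push τ.toOrderedGroupEmb (ExpCopy.log (ofLex p).1)
      + (P.l (τ.toOrderedGroupEmb (ofLex p).2)).1 := by
  rw [nextFun, map_add, extLog_extE, extLog_inclHom]

lemma nextFun_add (p q : S.next.Γ) : τ.nextFun (p + q) = τ.nextFun p + τ.nextFun q := by
  apply P.extLog_injective
  rw [map_add, extLog_nextFun, extLog_nextFun, extLog_nextFun]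
  have h1 : ExpCopy.log (ofLex (p + q)).1
      = ExpCopy.log (ofLex p).1 + ExpCopy.log (ofLex q).1 := rfl
  have h2 : (ofLex (p + q)).2 = (ofLex p).2 + (ofLex q).2 := rfl
  rw [h1, h2, map_add, OrderedGroupEmb.apply_add, map_add, AddSubgroup.coe_add]
  abel

lemma nextFun_incl (γ : S.Γ) :
    τ.nextFun (S.incl γ) = P.inclHom.toOrderedGroupEmb (τ.toOrderedGroupEmb γ) := by
  apply P.extLog_injective
  rw [extLog_nextFun, extLog_inclHom]
  have h1 : ExpCopy.log (ofLex (S.incl γ)).1 = (0 : GenSeries k S.Γ) := rfl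
  have h2 : (ofLex (S.incl γ)).2 = γ := rfl
  rw [h1, h2, map_zero, zero_add]

lemma nextFun_e (α : seriesOn k (larger S.U)) :
    τ.nextFun (S.e α) = P.extE ⟨push τ.toOrderedGroupEmb α.1, τ.push_mem_purelyInf α⟩ := by
  apply P.extLog_injective
  rw [extLog_nextFun, extLog_extE]
  have h1 : ExpCopy.log (ofLex (S.e α)).1 = α.1 := rfl
  have h2 : (ofLex (S.e α)).2 = 0 := rfl
  rw [h1, h2, OrderedGroupEmb.apply_zero, map_zero, AddSubgroup.coe_zero, add_zero]

/-- The factor `e(α)` decides the order, as `τ(α)` dominates the logarithms of the monomials in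
`τ(G)`. -/
lemma nextFun_strictMono : StrictMono τ.nextFun := by
  intro p q h
  rcases Prod.Lex.lt_iff.1 h with h | ⟨h, h'⟩
  · rw [← extLog_lt_extLog, ← sub_pos, extLog_nextFun, extLog_nextFun]
    have h1 : push τ.toOrderedGroupEmb (ExpCopy.log (ofLex p).1)
        + (P.l (τ.toOrderedGroupEmb (ofLex p).2)).1
        - (push τ.toOrderedGroupEmb (ExpCopy.log (ofLex q).1)
          + (P.l (τ.toOrderedGroupEmb (ofLex q).2)).1)
        = push τ.toOrderedGroupEmb (ExpCopy.log (ofLex p).1 - ExpCopy.log (ofLex q).1)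
          + ((P.l (τ.toOrderedGroupEmb (ofLex p).2)).1
            - (P.l (τ.toOrderedGroupEmb (ofLex q).2)).1) := by
      rw [map_sub]
      abel
    rw [h1]
    have hmem : ∀ γ, (P.l (τ.toOrderedGroupEmb γ)).1
        ∈ seriesOn k {ε | ∀ δ ∈ larger S.U, τ.toOrderedGroupEmb δ < ε} :=
      fun γ ε hε δ hδ => τ.dominates γ ε hε δ hδ
    refine pos_add_of_lt (S := τ.toOrderedGroupEmb '' larger S.U) ?_
      (push_mem _ (fun γ hγ => Set.mem_image_of_mem _ hγ)
        (sub_mem (ExpCopy.log_mem _) (ExpCopy.log_mem _))) (sub_mem (hmem _) (hmem _)) ?_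
    · rintro _ ⟨δ, hδ, rfl⟩ ε hε
      exact hε δ hδ
    · rw [← map_zero (push τ.toOrderedGroupEmb)]
      refine push_strictMono _ (sub_pos.2 ?_)
      exact (ExpCopy.log_lt_log _ _).2 h
  · have h1 : ExpCopy.log (ofLex p).1 = ExpCopy.log (ofLex q).1 := congrArg ExpCopy.log h
    rw [← extLog_lt_extLog, extLog_nextFun, extLog_nextFun, h1]
    have h2 : (P.l (τ.toOrderedGroupEmb (ofLex q).2)).1
        < (P.l (τ.toOrderedGroupEmb (ofLex p).2)).1 :=
      P.l_strictAnti (τ.strictMono h')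
    exact add_lt_add_right h2 _

/-- The embedding of the next stage into the exponential extension, given by
`e(α) γ ↦ e(τ(α)) τ(γ)`. -/
def next : StageEmb S.next P.ext where
  toFun := τ.nextFun
  map_zero' := by
    have := τ.nextFun_add 0 0
    rw [add_zero] at this
    exact left_eq_add.1 this
  map_add' := τ.nextFun_add
  strictMono := τ.nextFun_strictMono
  dominates p ε hε δ hδ := by
    rw [ext_l_eq] at hε
    obtain ⟨ε, hε', rfl⟩ := supp_push _ _ hε
    replace hε' : ε ∈ supp (P.extLog (τ.nextFun p)) := hε'
    rw [extLog_nextFun] at hε'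
    have hδ' : ∀ γ, δ < S.incl γ := fun γ => hδ _ ((S.mem_next_U _).2 rfl)
    rcases HahnSeries.support_add_subset
      (x := ofLex (push τ.toOrderedGroupEmb (ExpCopy.log (ofLex p).1)))
      (y := ofLex (P.l (τ.toOrderedGroupEmb (ofLex p).2)).1) hε' with h | h
    · obtain ⟨γ, -, rfl⟩ := supp_push _ _ h
      rw [← nextFun_incl]
      exact τ.nextFun_strictMono (hδ' γ)
    · -- `δ = e(α) γ'` with `α ≠ 0`; any monomial `γ` of `α` separates `δ` and `ε`
      have h1 : ExpCopy.log (ofLex δ).1 ≠ 0 := by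
        intro h0
        have h2 := hδ' (ofLex δ).2
        have h3 : δ = S.incl (ofLex δ).2 :=
          ofLex.injective (Prod.ext (ExpCopy.log_injective h0) rfl)
        exact h2.ne h3
      obtain ⟨γ, hγ⟩ := HahnSeries.support_nonempty_iff.2
        (show ofLex (ExpCopy.log (ofLex δ).1) ≠ 0 from h1)
      have h2 := τ.dominates _ _ h γ (ExpCopy.log_mem (ofLex δ).1 hγ)
      refine (τ.nextFun_strictMono (hδ' γ)).trans ?_
      rw [nextFun_incl]
      exact P.inclHom.strictMono h2

end StageEmb

/-! ### The embedding of the LE-series given by a sequence of iterated logarithms -/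

/-- Powers `(log_m x)^r` of iterated logarithms in a prelogarithmic field: for all `m` an embedding
`r ↦ (log_m x)^r` of the ordered group `k` into the group of monomials, with
`log ((log_m x)^r) = r log_{m+1} x` and `log_{m+1} x < log_m x`. -/
structure LogSystem (P : PrelogField k) where
  /-- the embedding `r ↦ (log_m x)^r` -/
  pow : ℕ → OrderedGroupEmb (stage k 0).Γ P.Γ
  l_pow : ∀ m r, (P.l (pow m (xPow k r))).1
    = toLex (HahnSeries.single (pow (m + 1) (xPow k 1)) r)
  pow_lt : ∀ m, pow m (xPow k 1) < pow (m + 1) (xPow k 1)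

namespace LogSystem

open PrelogField

variable {P : PrelogField k} (T : LogSystem P)

/-- Each power `(log_m x)^s`, `s > 0`, is larger than `log_{m+1} x`. -/
lemma pow_lt_pow (m : ℕ) {s : k} (hs : 0 < s) :
    T.pow m (xPow k s) < T.pow (m + 1) (xPow k 1) := by
  rw [← P.l_strictAnti.lt_iff_gt]
  change (P.l (T.pow (m + 1) (xPow k 1))).1 < (P.l (T.pow m (xPow k s))).1
  rw [l_pow, l_pow]
  refine (HahnSeries.lt_iff _ _).2 ⟨T.pow (m + 1) (xPow k 1), fun j hj => ?_, ?_⟩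
  · simp only [ofLex_toLex]
    rw [HahnSeries.coeff_single_of_ne hj.ne,
      HahnSeries.coeff_single_of_ne (hj.trans (T.pow_lt (m + 1))).ne]
  · simp only [ofLex_toLex]
    rw [HahnSeries.coeff_single_same, HahnSeries.coeff_single_of_ne (T.pow_lt (m + 1)).ne]
    exact hs

/-- The embedding of `G_n`, as a group of monomials of the `m`-th copy of `k((x^{-1}))^E`, into
`G^{#n}`. -/
def emb (m : ℕ) : ∀ n, StageEmb (stage k n) (P.iter n)
  | 0 =>
    { toOrderedGroupEmb := T.pow m
      dominates := by
        intro γ ε hε δ hδ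
        have h1 := T.l_pow m (OrderDual.ofDual γ)
        have h2 : ε ∈ supp (toLex (HahnSeries.single (T.pow (m + 1) (xPow k 1))
          (OrderDual.ofDual γ : k))) := h1 ▸ hε
        rw [show ε = _ from HahnSeries.support_single_subset h2]
        exact T.pow_lt_pow m (s := OrderDual.ofDual δ) (hδ 0 (AddSubgroup.zero_mem _)) }
  | n + 1 => (emb m n).next

lemma emb_incl (m n : ℕ) (γ : (stage k n).Γ) :
    (T.emb m (n + 1)).toOrderedGroupEmb (stageIncl k n γ)
      = P.inclIter n ((T.emb m n).toOrderedGroupEmb γ) :=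
  (T.emb m n).nextFun_incl γ

lemma emb_e (m n : ℕ) (α : seriesOn k (larger (stage k n).U)) :
    (T.emb m (n + 1)).toOrderedGroupEmb (stageE k n α)
      = (P.iter n).extE ⟨push (T.emb m n).toOrderedGroupEmb α.1,
        (T.emb m n).push_mem_purelyInf α⟩ :=
  (T.emb m n).nextFun_e α

/-- The embedding of the `m`-th copy of `k((x^{-1}))^E`. -/
def embE (m : ℕ) : EField k →+*o P.EL :=
  ChainUnion.lift (fun n => (elOf P n).comp (push (T.emb m n).toOrderedGroupEmb)) fun n f => by
    rw [OrderRingHom.comp_apply, OrderRingHom.comp_apply, push_push (stageIncl k n)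
      (T.emb m (n + 1)).toOrderedGroupEmb (T.emb m n).toOrderedGroupEmb (P.inclIter n)
      (T.emb_incl m n), elOf_succ]

/-- The inclusion of `K_n` into `k((x^{-1}))^E`. -/
def eOf (k : Type u) [Field k] [LinearOrder k] [IsStrictOrderedRing k] (n : ℕ) :
    KE k n →+*o EField k :=
  ChainUnion.of (X := KE k) (fun n => push (stageIncl k n)) n

lemma embE_eOf (m n : ℕ) (f : KE k n) :
    T.embE m (eOf k n f) = elOf P n (push (T.emb m n).toOrderedGroupEmb f) := rfl

lemma compExpE_eOf (n : ℕ) (f : KE k n) :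
    compExpE k (eOf k n f) = eOf k (n + 1) (push (compExpStage k n).toOrderedGroupEmb f) := rfl

/-- Substituting `exp x` for `x` turns `log_{m+1} x` into `log_m x`. -/
lemma emb_compExpStage (m n : ℕ) (γ : (stage k n).Γ) :
    (T.emb (m + 1) (n + 1)).toOrderedGroupEmb ((compExpStage k n).toOrderedGroupEmb γ)
      = P.inclIter n ((T.emb m n).toOrderedGroupEmb γ) := by
  induction n with
  | zero =>
    refine (T.emb_e (m + 1) 0 (smulX k (OrderDual.ofDual γ))).trans ?_
    apply P.extLog_injective
    refine Eq.trans ?_ (T.l_pow m (OrderDual.ofDual γ)).symm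
    exact congrArg toLex (HahnSeries.embDomain_single (f := OrderEmbedding.ofStrictMono
      (T.pow (m + 1)).toFun (T.pow (m + 1)).strictMono))
  | succ n ih =>
    apply (P.iter (n + 1)).extLog_injective
    refine ((T.emb (m + 1) (n + 1)).extLog_nextFun _).trans ?_
    have h1 := push_push (compExpStage k n).toOrderedGroupEmb
      (T.emb (m + 1) (n + 1)).toOrderedGroupEmb (T.emb m n).toOrderedGroupEmb
      (P.inclIter n) ih (ExpCopy.log (ofLex γ).1)
    have h2 := congrArg (fun g => ((P.iter (n + 1)).l g).1) (ih (ofLex γ).2)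
    refine (congrArg₂ (· + ·) h1 h2).trans ?_
    have h3 := congrArg (push (P.inclIter n)) ((T.emb m n).extLog_nextFun γ)
    rw [map_add] at h3
    exact h3.symm

lemma embE_compExpE (m : ℕ) (a : EField k) : T.embE (m + 1) (compExpE k a) = T.embE m a := by
  obtain ⟨n, f, rfl⟩ := ChainUnion.exists_of _ a
  change T.embE (m + 1) (compExpE k (eOf k n f)) = T.embE m (eOf k n f)
  rw [compExpE_eOf, embE_eOf, embE_eOf, push_push _ _ (T.emb m n).toOrderedGroupEmb (P.inclIter n)
    (T.emb_compExpStage m n), elOf_succ]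

/-- The embedding of the field of LE-series. -/
def embLE : LEField k →+*o P.EL := ChainUnion.lift T.embE T.embE_compExpE

lemma embLE_of (m : ℕ) (a : EField k) :
    T.embLE (ChainUnion.of (fun _ => compExpE k) m a) = T.embE m a := rfl

lemma embLE_of_of (m n : ℕ) (f : KE k n) :
    T.embLE (LEField.of k m n f) = elOf P n (push (T.emb m n).toOrderedGroupEmb f) := rfl

lemma exists_LEField_of (a : LEField k) : ∃ m n f, LEField.of k m n f = a := by
  obtain ⟨m, a, rfl⟩ := ChainUnion.exists_of _ a
  obtain ⟨n, f, rfl⟩ := ChainUnion.exists_of _ a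
  exact ⟨m, n, f, rfl⟩

lemma embLE_injective : Function.Injective T.embLE := (T.embLE : LEField k →+* P.EL).injective

lemma embLE_strictMono : StrictMono T.embLE :=
  T.embLE.monotone'.strictMono_of_injective T.embLE_injective

lemma embLE_const (c : k) : T.embLE (LEField.const k c) = EL.const P c := by
  refine (T.embLE_of_of 0 0 _).trans ?_
  rw [push_const]
  rfl

lemma embLE_x : T.embLE (LEField.x k) = EL.monomial P (T.pow 0 (xPow k 1)) := by
  refine (T.embLE_of_of 0 0 _).trans ?_
  rw [push_monomial]
  rfl

end LogSystem

/-! ### The exponential of the LE-series -/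

namespace LogSystem

open PrelogField

variable {P : PrelogField k} (T : LogSystem P) {expk : k → k} (hexp : IsOrderedExp expk)

lemma eq_parts_of_zero (f : KE k 0) :
    f = part (larger (stage k 0).U) f + const ((ofLex f).coeff 0)
      + part (smaller (stage k 0).U) f := by
  have h1 : larger (stage k 0).U = Set.Iio 0 := by
    refine Set.Subset.antisymm (larger_subset_Iio _) fun γ hγ u hu => ?_
    rw [AddSubgroup.mem_bot.1 hu]
    exact hγ
  have h2 : smaller (stage k 0).U = Set.Ioi 0 := by
    refine Set.Subset.antisymm (smaller_subset_Ioi _) fun γ hγ u hu => ?_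
    rw [AddSubgroup.mem_bot.1 hu]
    exact hγ
  rw [h1, h2]
  exact eq_part_add_const_add_part f

/-- Every series in `K_{n+1}` is the sum of a series whose monomials are larger than `G_n`, a series
in `K_n`, and a series whose monomials are smaller than `G_n`. -/
lemma eq_parts_of_succ (n : ℕ) (f : KE k (n + 1)) :
    f = part (larger (stage k (n + 1)).U) f + push (stageIncl k n) (pull (stageIncl k n) f)
      + part (smaller (stage k (n + 1)).U) f := by
  refine genSeries_ext fun p => ?_
  rw [coeff_add', coeff_add', coeff_part, coeff_part]
  have hlt : ∀ p q : (stage k (n + 1)).Γ, (ofLex p).1 < (ofLex q).1 → p < q :=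
    fun p q h => Prod.Lex.lt_iff.2 (Or.inl h)
  have hU : ∀ u ∈ (stage k (n + 1)).U, (ofLex u).1 = 0 :=
    fun u hu => ((stage k n).mem_next_U u).1 hu
  rcases lt_trichotomy (ofLex p).1 0 with h | h | h
  · have h1 : p ∈ larger (stage k (n + 1)).U := fun u hu => hlt _ _ (by rw [hU u hu]; exact h)
    have h2 : p ∉ smaller (stage k (n + 1)).U := fun h' =>
      (lt_asymm (larger_subset_Iio _ h1) (smaller_subset_Ioi _ h'))
    have h3 : p ∉ Set.range (stageIncl k n) := by
      rintro ⟨γ, rfl⟩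
      exact lt_irrefl _ h
    rw [Set.indicator_of_mem h1, Set.indicator_of_notMem h2, coeff_push_of_notMem _ _ h3]
    simp
  · have hp : p ∈ (stage k (n + 1)).U := ((stage k n).mem_next_U p).2 h
    have h1 : p ∉ larger (stage k (n + 1)).U := fun h' => lt_irrefl _ (h' p hp)
    have h2 : p ∉ smaller (stage k (n + 1)).U := fun h' => lt_irrefl _ (h' p hp)
    have h3 : p = stageIncl k n (ofLex p).2 := ofLex.injective (Prod.ext h rfl)
    rw [Set.indicator_of_notMem h1, Set.indicator_of_notMem h2, zero_add, add_zero, h3, push_coeff]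
    rfl
  · have h1 : p ∈ smaller (stage k (n + 1)).U := fun u hu => hlt _ _ (by rw [hU u hu]; exact h)
    have h2 : p ∉ larger (stage k (n + 1)).U := fun h' =>
      (lt_asymm (smaller_subset_Ioi _ h1) (larger_subset_Iio _ h'))
    have h3 : p ∉ Set.range (stageIncl k n) := by
      rintro ⟨γ, rfl⟩
      exact lt_irrefl _ h
    rw [Set.indicator_of_mem h1, Set.indicator_of_notMem h2, coeff_push_of_notMem _ _ h3]
    simp

lemma elOf_push_stageIncl (m n : ℕ) (f : KE k n) :
    elOf P (n + 1) (push (T.emb m (n + 1)).toOrderedGroupEmb (push (stageIncl k n) f))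
      = elOf P n (push (T.emb m n).toOrderedGroupEmb f) := by
  rw [push_push (stageIncl k n) _ (T.emb m n).toOrderedGroupEmb (P.inclIter n)
    (T.emb_incl m n), elOf_succ]

include hexp

lemma exp_elOf_push_larger (m n : ℕ) (α : seriesOn k (larger (stage k n).U)) :
    EL.exp expk P (elOf P n (push (T.emb m n).toOrderedGroupEmb α.1))
      = elOf P (n + 1) (push (T.emb m (n + 1)).toOrderedGroupEmb
        (monomial k (stageE k n α))) := by
  rw [push_monomial, emb_e]
  exact exp_elOf_purelyInf hexp P n ⟨_, (T.emb m n).push_mem_purelyInf α⟩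

lemma exp_elOf_push_infinitesimal (m n : ℕ) {ε : KE k n} (hε : ε ∈ infinitesimal k _) :
    EL.exp expk P (elOf P n (push (T.emb m n).toOrderedGroupEmb ε))
      = elOf P n (push (T.emb m n).toOrderedGroupEmb (expSeries ε)) := by
  rw [push_expSeries _ hε]
  exact exp_elOf_infinitesimal hexp P n (push_infinitesimal _ hε)

lemma exp_elOf_push_const (m n : ℕ) (c : k) :
    EL.exp expk P (elOf P n (push (T.emb m n).toOrderedGroupEmb (const c)))
      = elOf P n (push (T.emb m n).toOrderedGroupEmb (const (expk c))) := by
  rw [push_const, push_const]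
  exact exp_elOf_const hexp P n c

/-- The maps on the members of the chain take the exponential `K_n → K_{n+1}` to `Exp`. -/
lemma exp_elOf_push (m n : ℕ) (f : KE k n) :
    EL.exp expk P (elOf P n (push (T.emb m n).toOrderedGroupEmb f))
      = elOf P (n + 1) (push (T.emb m (n + 1)).toOrderedGroupEmb (expStage expk n f)) := by
  have hE := isOrderedExp_exp hexp P
  have hlarge : ∀ (n : ℕ) (f : KE k n), _ := fun n f => T.exp_elOf_push_larger hexp m n
    ⟨part (larger (stage k n).U) f, part_mem _ f⟩
  have hsmall : ∀ (n : ℕ) (f : KE k n), _ := fun n f => T.exp_elOf_push_infinitesimal hexp m n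
    (seriesOn_mono (smaller_subset_Ioi (stage k n).U) (part_mem _ f))
  induction n with
  | zero =>
    conv_lhs => rw [eq_parts_of_zero f]
    rw [map_add, map_add, map_add, map_add, hE.map_add, hE.map_add, hlarge, hsmall,
      T.exp_elOf_push_const hexp, ← T.elOf_push_stageIncl m 0 (const _),
      ← T.elOf_push_stageIncl m 0 (expSeries _), push_const (stageIncl k 0),
      ← map_mul, ← map_mul, ← map_mul, ← map_mul]
    rfl
  | succ n ih =>
    conv_lhs => rw [eq_parts_of_succ n f]
    rw [map_add, map_add, map_add, map_add, hE.map_add, hE.map_add, hlarge, hsmall,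
      T.elOf_push_stageIncl m n, ih,
      ← T.elOf_push_stageIncl m (n + 1) (expStage expk n _),
      ← T.elOf_push_stageIncl m (n + 1) (expSeries _),
      ← map_mul, ← map_mul, ← map_mul, ← map_mul]
    rfl

lemma embE_exp (m : ℕ) (a : EField k) :
    T.embE m (EField.exp expk a) = EL.exp expk P (T.embE m a) := by
  have h := ChainUnion.exists_of (X := KE k) (fun n => push (stageIncl k n)) a
  have h1 := T.exp_elOf_push hexp m h.choose h.choose_spec.choose
  have h2 : eOf k h.choose h.choose_spec.choose = a := h.choose_spec.choose_spec
  rw [← embE_eOf, h2] at h1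
  exact h1.symm

/-- The embedding of the field of LE-series respects exponentials. -/
lemma embLE_exp (a : LEField k) :
    T.embLE (LEField.exp expk a) = EL.exp expk P (T.embLE a) := by
  have h := ChainUnion.exists_of (X := fun _ : ℕ => EField k) (fun _ => compExpE k) a
  have h1 := T.embE_exp hexp h.choose h.choose_spec.choose
  rw [← embLE_of, ← embLE_of, h.choose_spec.choose_spec] at h1
  exact h1

lemma isExpEmbedding_embLE :
    IsExpEmbedding (LEField.exp expk) (EL.exp expk P) (T.embLE : LEField k →+* P.EL) :=
  ⟨T.embLE_strictMono, T.embLE_exp hexp⟩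

include T

/-- Every monomial of the field of LE-series is an exponential: `e(α)` is that of `α`, and a power
of `log_m x` is one of a multiple of `log_{m+1} x`. -/
lemma exists_exp_eq_monomial (m n : ℕ) (γ : (stage k n).Γ) :
    ∃ b, LEField.exp expk b = LEField.of k m n (monomial k γ) := by
  have hE := isOrderedExp_exp hexp P
  suffices h : ∃ b, EL.exp expk P (T.embLE b) = T.embLE (LEField.of k m n (monomial k γ)) by
    obtain ⟨b, hb⟩ := h
    exact ⟨b, T.embLE_injective ((T.embLE_exp hexp b).trans hb)⟩
  induction n with
  | zero =>
    refine ⟨LEField.of k (m + 1) 0 (smulX k (OrderDual.ofDual γ)).1, ?_⟩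
    rw [embLE_of_of, exp_elOf_push_larger T hexp, embLE_of_of, ← elOf_succ P 0,
      push_monomial, push_monomial, push_monomial, ← T.emb_compExpStage]
    rfl
  | succ n ih =>
    obtain ⟨b, hb⟩ := ih (ofLex γ).2
    set α : seriesOn k (larger (stage k n).U) := ⟨ExpCopy.log (ofLex γ).1, ExpCopy.log_mem _⟩
    refine ⟨LEField.of k m n α.1 + b, ?_⟩
    have h1 : γ = stageE k n α + stageIncl k n (ofLex γ).2 :=
      ofLex.injective (Prod.ext (add_zero (ofLex γ).1).symm (zero_add (ofLex γ).2).symm)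
    rw [map_add, hE.map_add, hb, embLE_of_of, exp_elOf_push_larger T hexp, embLE_of_of, embLE_of_of,
      ← T.elOf_push_stageIncl m n (monomial k _), ← map_mul, ← map_mul,
      push_monomial (stageIncl k n), ← monomial_add, ← h1]

/-- The field of LE-series is an ordered exponential field. -/
lemma isOrderedExp_LEField_exp : IsOrderedExp (LEField.exp (k := k) expk) := by
  have hE := isOrderedExp_exp hexp P
  have hadd : ∀ a b : LEField k,
      LEField.exp expk (a + b) = LEField.exp expk a * LEField.exp expk b := fun a b => by
    apply T.embLE_injective
    rw [map_mul, T.embLE_exp hexp, T.embLE_exp hexp, T.embLE_exp hexp, map_add, hE.map_add]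
  refine ⟨fun a b h => ?_, hadd, Set.Subset.antisymm ?_ fun a ha => ?_⟩
  · rw [← T.embLE_strictMono.lt_iff_lt, T.embLE_exp hexp, T.embLE_exp hexp]
    exact hE.strictMono (T.embLE_strictMono h)
  · rintro _ ⟨a, rfl⟩
    change 0 < LEField.exp expk a
    rw [← T.embLE_strictMono.lt_iff_lt, T.embLE_exp hexp, map_zero]
    exact hE.pos _
  · obtain ⟨m, n, f, rfl⟩ := exists_LEField_of a
    have hof : StrictMono (LEField.of k m n) :=
      (LEField.of k m n).monotone'.strictMono_of_injective
        (LEField.of k m n : KE k n →+* LEField k).injective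
    have hf : 0 < f := by
      rw [← hof.lt_iff_lt, map_zero]
      exact ha
    obtain ⟨γ, c, ε, hc, hε, rfl⟩ := exists_decomposition hf
    obtain ⟨b, hb⟩ := T.exists_exp_eq_monomial hexp m n γ
    refine ⟨b + LEField.of k m n (const (Function.invFun expk c))
      + LEField.of k m n (logSeries ε), ?_⟩
    have h1 : LEField.exp expk (LEField.of k m n (const (Function.invFun expk c)))
        = LEField.of k m n (const c) := by
      apply T.embLE_injective
      rw [T.embLE_exp hexp, embLE_of_of, T.exp_elOf_push_const hexp, hexp.exp_log hc]
      rfl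
    have h2 : LEField.exp expk (LEField.of k m n (logSeries ε)) = LEField.of k m n (1 + ε) := by
      apply T.embLE_injective
      rw [T.embLE_exp hexp, embLE_of_of, T.exp_elOf_push_infinitesimal hexp _ _ (logSeries_mem hε),
        expSeries_logSeries hε]
      rfl
    rw [hadd, hadd, hb, h1, h2, ← map_mul, ← map_mul]

end LogSystem

/-! ### Iterated logarithms in the examples -/

namespace LogSystem

open PrelogField

/-- The image of a system of iterated logarithms under a morphism. -/
def comp {P Q : PrelogField k} (T : LogSystem P) (ι : Hom P Q) : LogSystem Q where
  pow m :=
    { toAddMonoidHom := ι.toAddMonoidHom.comp (T.pow m).toAddMonoidHom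
      strictMono := fun _ _ h => ι.strictMono ((T.pow m).strictMono h) }
  l_pow m r := by
    refine ((ι.comm _).symm.trans (congrArg (push ι.toOrderedGroupEmb) (T.l_pow m r))).trans ?_
    exact congrArg toLex (HahnSeries.embDomain_single
      (f := OrderEmbedding.ofStrictMono ι.toFun ι.strictMono))
  pow_lt m := ι.strictMono (T.pow_lt m)

variable (k) in
/-- The powers `(log_m x)^r` as logarithmic words. -/
def words : LogSystem (logWords k) where
  pow m :=
    { toFun := fun r => (Word.logPow m (OrderDual.ofDual r : k) :)
      map_zero' := Word.exponents_injective (Finsupp.single_zero m)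
      map_add' := fun r s => Word.exponents_injective (Finsupp.single_add m _ _)
      strictMono := fun r s (h : (OrderDual.ofDual s : k) < OrderDual.ofDual r) => by
        refine (Word.lt_iff _ _).2 ⟨m, fun j hj => ?_, ?_⟩
        · exact (Finsupp.single_eq_of_ne hj.ne).trans (Finsupp.single_eq_of_ne hj.ne).symm
        · exact Finsupp.single_eq_same.trans_lt (h.trans_eq Finsupp.single_eq_same.symm) }
  l_pow m r := by
    have h : ofLex (Word.series k (Word.logPow m r)) = HahnSeries.single m r := by
      ext i
      refine (Word.series_coeff _ i).trans ?_
      rcases eq_or_ne i m with rfl | hi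
      · rw [HahnSeries.coeff_single_same]
        exact Finsupp.single_eq_same
      · rw [HahnSeries.coeff_single_of_ne hi]
        exact Finsupp.single_eq_of_ne hi
    refine (congrArg (fun f => toLex (HahnSeries.embDomain (Word.logEmb k) f)) h).trans ?_
    exact congrArg toLex HahnSeries.embDomain_single
  pow_lt m := Word.logPow_strictMono k m.lt_succ_self

/-- The powers `x_i^r, x_{σ i}^r, x_{σ² i}^r, …` of generators of the Hahn group as powers of
iterated logarithms of `x_i`. -/
def hahn (I : Type u) [LinearOrder I] (σ : I → I) (hσ : StrictMono σ) (h : ∀ i, σ i < i) (i : I) :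
    LogSystem (hahnField k I σ hσ) where
  pow m :=
    { toFun := fun r => HahnGroup.mk
        (toLex (HahnSeries.single (OrderDual.toDual (σ^[m] i)) (OrderDual.ofDual r : k)))
      map_zero' := congrArg (fun f => HahnGroup.mk (toLex f)) HahnSeries.single_eq_zero
      map_add' := fun r s =>
        congrArg (fun f => HahnGroup.mk (toLex f)) (HahnSeries.single_add _ _ _)
      strictMono := fun r s (hrs : (OrderDual.ofDual s : k) < OrderDual.ofDual r) => by
        refine (HahnSeries.lt_iff _ _).2 ⟨OrderDual.toDual (σ^[m] i), fun j hj => ?_, ?_⟩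
        · exact (HahnSeries.coeff_single_of_ne hj.ne).trans
            (HahnSeries.coeff_single_of_ne hj.ne).symm
        · exact (HahnSeries.coeff_single_same _ _).trans_lt
            (hrs.trans_eq (HahnSeries.coeff_single_same _ _).symm) }
  l_pow m r := by
    refine (congrArg toLex (HahnSeries.embDomain_single
      (f := HahnGroup.genEmb k σ hσ) (g := OrderDual.toDual (σ^[m] i)) (r := r))).trans ?_
    change toLex (HahnSeries.single (HahnGroup.gen k (σ (σ^[m] i))) r)
      = toLex (HahnSeries.single (HahnGroup.gen k (σ^[m + 1] i)) r)
    rw [Function.iterate_succ_apply']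
  pow_lt m := by
    change HahnGroup.gen k (σ^[m] i) < HahnGroup.gen k (σ^[m + 1] i)
    rw [Function.iterate_succ_apply']
    exact HahnGroup.gen_strictAnti (h _)

/-! ### The groups `G_m^n` and the shift of logarithmic words -/

/-- The embeddings of the groups `G_n` are natural with respect to morphisms. -/
lemma emb_hom {P Q : PrelogField k} (T : LogSystem P) (T' : LogSystem Q) (ι : Hom P Q) {m m' : ℕ}
    (h : ∀ r, ι.toOrderedGroupEmb (T.pow m r) = T'.pow m' r) (n : ℕ) (γ : (stage k n).Γ) :
    (ι.iter n).toOrderedGroupEmb ((T.emb m n).toOrderedGroupEmb γ)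
      = (T'.emb m' n).toOrderedGroupEmb γ := by
  induction n with
  | zero => exact h γ
  | succ n ih =>
    apply (Q.iter n).extLog_injective
    refine Eq.trans ?_ ((T'.emb m' n).extLog_nextFun γ).symm
    have h1 := congrArg (push (ι.iter n).toOrderedGroupEmb) ((T.emb m n).extLog_nextFun γ)
    rw [map_add] at h1
    refine Eq.trans h1 (congrArg₂ (· + ·) ?_ ?_)
    · exact push_comp _ _ (T'.emb m' n).toOrderedGroupEmb ih _
    · rw [(ι.iter n).comm]
      exact congrArg (fun g => ((Q.iter n).l g).1) (ih (ofLex γ).2)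

/-- The groups of the construction `LE(H, ψ)` are the images of the groups `G_{n-1}` and `G_n`. -/
lemma chainPair_eq {P : PrelogField k} (T : LogSystem P) (m : ℕ) (H : AddSubgroup P.Γ)
    (hH : H = (T.pow m).toAddMonoidHom.range) (n : ℕ) :
    P.chainPair H n = ((stage k n).U.map (T.emb m n).toAddMonoidHom,
      (T.emb m n).toAddMonoidHom.range) := by
  induction n with
  | zero =>
    refine Prod.ext ?_ hH
    exact (AddSubgroup.map_bot _).symm
  | succ n ih =>
    have hG : (P.chainPair H n).2 = (T.emb m n).toAddMonoidHom.range := by rw [ih]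
    have hU : (P.chainPair H n).1 = (stage k n).U.map (T.emb m n).toAddMonoidHom := by rw [ih]
    have h1 : (P.chainPair H (n + 1)).1
        = (stage k (n + 1)).U.map (T.emb m (n + 1)).toAddMonoidHom := by
      change (P.chainPair H n).2.map (P.inclIter n).toAddMonoidHom = _
      rw [hG]
      ext g
      constructor
      · rintro ⟨_, ⟨γ, rfl⟩, rfl⟩
        exact ⟨stageIncl k n γ, ((stage k n).mem_next_U _).2 rfl, T.emb_incl m n γ⟩
      · rintro ⟨p, hp, rfl⟩
        have hp' : p = stageIncl k n (ofLex p).2 :=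
          ofLex.injective (Prod.ext (((stage k n).mem_next_U p).1 hp) rfl)
        rw [hp']
        exact ⟨_, ⟨_, rfl⟩, (T.emb_incl m n _).symm⟩
    have hS : ((P.chainPair H n).2 : Set (P.iter n).Γ) ∩ larger (P.chainPair H n).1
        = (T.emb m n).toOrderedGroupEmb '' larger (stage k n).U := by
      rw [hG, hU]
      ext g
      constructor
      · rintro ⟨⟨γ, rfl⟩, h⟩
        exact ⟨γ, fun u hu => (T.emb m n).strictMono.lt_iff_lt.1 (h _ ⟨u, hu, rfl⟩), rfl⟩
      · rintro ⟨γ, h, rfl⟩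
        refine ⟨⟨γ, rfl⟩, ?_⟩
        rintro _ ⟨u, hu, rfl⟩
        exact (T.emb m n).strictMono (h u hu)
    refine Prod.ext h1 ?_
    change (P.chainPair H n).2.map (P.inclIter n).toAddMonoidHom
      ⊔ (seriesOn k (_ ∩ larger _)).comap (P.iter n).extLog = _
    rw [hS, hG]
    ext g
    rw [AddSubgroup.mem_sup]
    constructor
    · rintro ⟨_, ⟨_, ⟨γ, rfl⟩, rfl⟩, z, hz, rfl⟩
      obtain ⟨α, hα, hαz⟩ := (mem_seriesOn_image_iff _).1 (AddSubgroup.mem_comap.1 hz)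
      refine ⟨stageIncl k n γ + stageE k n ⟨α, hα⟩, ?_⟩
      rw [map_add]
      refine congrArg₂ (· + ·) (T.emb_incl m n γ) ((T.emb_e m n _).trans ?_)
      exact (P.iter n).extLog_injective hαz
    · rintro ⟨p, rfl⟩
      refine ⟨_, ⟨_, ⟨(ofLex p).2, rfl⟩, rfl⟩, _, ?_, add_comm _ _⟩
      refine AddSubgroup.mem_comap.2 ((mem_seriesOn_image_iff _).2
        ⟨_, ExpCopy.log_mem (ofLex p).1, rfl⟩)

/-- `G_m^n` is the image of `G_n` in the exponential extensions of the logarithmic words. -/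
lemma range_words_emb (m n : ℕ) :
    ((words k).emb m n).toAddMonoidHom.range = (logWords k).group (powersX k) (shift k) m n := by
  have hH : (AddSubgroup.map (shift k).toAddMonoidHom)^[m] (powersX k)
      = ((words k).pow m).toAddMonoidHom.range := by
    induction m with
    | zero =>
      ext w
      exact ⟨fun ⟨r, h⟩ => ⟨r, h.symm⟩, fun ⟨r, h⟩ => ⟨r, h.symm⟩⟩
    | succ m ih =>
      refine ((Function.iterate_succ_apply' _ _ _).trans
        (congrArg (AddSubgroup.map (shift k).toAddMonoidHom) ih)).trans ?_
      ext w
      constructor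
      · rintro ⟨_, ⟨r, rfl⟩, rfl⟩
        exact ⟨r, (Word.shift_logPow m _).symm⟩
      · rintro ⟨r, rfl⟩
        exact ⟨_, ⟨r, rfl⟩, Word.shift_logPow m _⟩
  exact (congrArg Prod.snd ((words k).chainPair_eq m _ hH n)).symm

lemma image_words_L (m : ℕ) :
    (words k).embLE '' LEField.L k m = (logWords k).L (powersX k) (shift k) m := by
  ext a
  constructor
  · rintro ⟨_, ⟨b, rfl⟩, rfl⟩
    obtain ⟨n, f, rfl⟩ := ChainUnion.exists_of _ b
    refine ⟨n, push ((words k).emb m n).toOrderedGroupEmb f, ?_, rfl⟩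
    rw [← range_words_emb]
    intro γ hγ
    obtain ⟨δ, -, rfl⟩ := supp_push _ _ hγ
    exact ⟨δ, rfl⟩
  · rintro ⟨n, f, hf, rfl⟩
    rw [← range_words_emb] at hf
    refine ⟨LEField.of k m n (pull ((words k).emb m n).toOrderedGroupEmb f), ⟨_, rfl⟩, ?_⟩
    rw [embLE_of_of, push_pull _ hf]
    rfl

lemma range_words_embLE :
    Set.range (words k).embLE = (logWords k).LE (powersX k) (shift k) := by
  change _ = ⋃ m, (logWords k).L (powersX k) (shift k) m
  simp only [← image_words_L]
  rw [← Set.image_iUnion]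
  have h : ⋃ m, LEField.L k m = Set.univ := by
    refine Set.eq_univ_of_forall fun a => Set.mem_iUnion.2 ?_
    obtain ⟨m, b, rfl⟩ := ChainUnion.exists_of _ a
    exact ⟨m, b, rfl⟩
  rw [h, Set.image_univ]

lemma words_L_subset (m : ℕ) : (logWords k).L (powersX k) (shift k) m
    ⊆ (logWords k).L (powersX k) (shift k) (m + 1) := by
  rw [← image_words_L, ← image_words_L]
  refine Set.image_mono ?_
  rintro _ ⟨b, rfl⟩
  exact ⟨compExpE k b,
    ChainUnion.of_succ (X := fun _ : ℕ => EField k) (fun _ => compExpE k) m b⟩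

/-- Composition with `exp x` becomes the inverse of the map induced by the shift. -/
lemma shift_EL_embLE_compExp (a : LEField k) :
    (shift k).EL ((words k).embLE (LEField.compExp k a)) = (words k).embLE a := by
  obtain ⟨m, n, f, rfl⟩ := exists_LEField_of a
  have hs : ∀ r, (shift k).toOrderedGroupEmb ((words k).pow m r) = (words k).pow (m + 1) r :=
    fun r => Word.shift_logPow m _
  have h1 : (words k).embLE (LEField.compExp k (LEField.of k m n f))
      = elOf _ (n + 1) (push ((words k).emb m (n + 1)).toOrderedGroupEmb
        (push (compExpStage k n).toOrderedGroupEmb f)) := rfl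
  have h2 : ∀ (g : GenSeries k ((logWords k).iter (n + 1)).Γ),
      (shift k).EL (elOf _ (n + 1) g)
        = elOf _ (n + 1) (push ((shift k).iter (n + 1)).toOrderedGroupEmb g) := fun _ => rfl
  rw [h1, h2, embLE_of_of, ← elOf_succ (logWords k) n]
  refine congrArg (elOf (logWords k) (n + 1)) ?_
  exact (push_comp _ _ ((words k).emb (m + 1) (n + 1)).toOrderedGroupEmb
    ((words k).emb_hom (words k) (shift k) hs (n + 1)) _).trans
    (push_push _ _ _ _ ((words k).emb_compExpStage m n) f)

end LogSystem

namespace PrelogField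

/-- A monomial `e(β)` is in the image of `ψ^#` if the monomials of `β` are in the image of `ψ`. -/
lemma Hom.exists_ext_eq {P Q : PrelogField k} (ψ : Hom P Q) {g : Q.ext.Γ}
    (hg : Q.extLog g ∈ seriesOn k (Set.range ψ.toOrderedGroupEmb)) :
    ∃ δ, ψ.ext.toOrderedGroupEmb δ = g := by
  have h : pull ψ.toOrderedGroupEmb (Q.extLog g) ∈ purelyInf k P.Γ := by
    refine pull_mem _ (Q.extLog_mem g) fun γ (hγ : ψ.toOrderedGroupEmb γ < 0) => ?_
    rw [← ψ.toOrderedGroupEmb.apply_zero] at hγ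
    exact ψ.strictMono.lt_iff_lt.1 hγ
  exact ⟨P.extE ⟨_, h⟩, Q.extLog_injective (push_pull _ hg)⟩

/-- The inclusion `G^{#n} → G^{#(n+1)}` for the logarithmic words takes values in the image of the
shift; for instance, `x = e(log x)` is the shift of `e(x)`. -/
lemma exists_shift_iter_eq (n : ℕ) (γ : ((logWords k).iter n).Γ) :
    ∃ δ, ((shift k).iter (n + 1)).toOrderedGroupEmb δ = (logWords k).inclIter n γ := by
  induction n with
  | zero =>
    refine (shift k).exists_ext_eq fun ε hε => ?_
    obtain ⟨i, -, rfl⟩ := logWords_l_supp γ hε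
    exact ⟨Word.logPow i 1, Word.shift_logPow i 1⟩
  | succ n ih =>
    refine ((shift k).iter (n + 1)).exists_ext_eq fun ε hε => ?_
    obtain ⟨δ, -, rfl⟩ := supp_push ((logWords k).inclIter n) (((logWords k).iter n).extLog γ) hε
    exact ih δ

lemma shift_EL_bijective : Function.Bijective (shift k).EL := by
  refine ⟨((shift k).EL : (logWords k).EL →+* (logWords k).EL).injective, fun a => ?_⟩
  obtain ⟨n, f, rfl⟩ := exists_elOf _ a
  have h : push ((logWords k).inclIter n) f
      ∈ seriesOn k (Set.range ((shift k).iter (n + 1)).toOrderedGroupEmb) := by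
    intro γ hγ
    obtain ⟨δ, -, rfl⟩ := supp_push _ _ hγ
    exact exists_shift_iter_eq n δ
  refine ⟨elOf _ (n + 1) (pull ((shift k).iter (n + 1)).toOrderedGroupEmb
    (push ((logWords k).inclIter n) f)), ?_⟩
  refine Eq.trans ?_ (elOf_succ _ n f)
  exact congrArg (elOf _ (n + 1)) (push_pull _ h)

end PrelogField

/-! ### Transseries -/

section Transseries

variable {expk : k → k}

lemma exp_mem_transseries {a : LEField k} (ha : a ∈ transseries expk) :
    LEField.exp expk a ∈ transseries expk := by
  rw [transseries, Subfield.mem_sInf] at *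
  exact fun F hF => hF.2.2.1 a (ha F hF)

lemma exists_exp_eq_of_mem_transseries (hE : IsOrderedExp (LEField.exp (k := k) expk))
    {a : LEField k} (ha : a ∈ transseries expk) (h0 : 0 < a) :
    ∃ b ∈ transseries expk, LEField.exp expk b = a := by
  refine ⟨_, ?_, hE.exp_log h0⟩
  rw [transseries, Subfield.mem_sInf] at *
  intro F hF
  obtain ⟨b, hb, h⟩ := hF.2.2.2.1 a (ha F hF) h0
  rwa [← h, hE.log_exp]

/-- The exponential of the field of transseries. -/
def transseriesExp (expk : k → k) (a : transseries expk) : transseries expk :=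
  ⟨LEField.exp expk a, exp_mem_transseries a.2⟩

lemma isOrderedExp_transseriesExp (hE : IsOrderedExp (LEField.exp (k := k) expk)) :
    IsOrderedExp (transseriesExp expk) := by
  refine ⟨fun a b h => hE.strictMono h, fun a b => Subtype.ext (hE.map_add a b),
    Set.Subset.antisymm ?_ fun a ha => ?_⟩
  · rintro _ ⟨a, rfl⟩
    exact hE.pos a
  · obtain ⟨b, hb, h⟩ := exists_exp_eq_of_mem_transseries hE a.2 ha
    exact ⟨⟨b, hb⟩, Subtype.ext h⟩

/-- The restriction to the transseries of the embedding given by iterated logarithms. -/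
lemma LogSystem.exists_isExpEmbedding_transseries (hexp : IsOrderedExp expk) {P : PrelogField k}
    (T : LogSystem P) : ∃ φ : transseries expk →+* P.EL,
      IsExpEmbedding (transseriesExp expk) (PrelogField.EL.exp expk P) φ :=
  ⟨(T.embLE : LEField k →+* P.EL).comp (transseries expk).subtype,
    fun _ _ h => T.embLE_strictMono h, fun a => T.embLE_exp hexp a⟩

end Transseries

end LESeries

end

open LESeries
theorem mainTheorem1 {k : Type u} [Field k] [LinearOrder k] [IsStrictOrderedRing k]
    (expk : k → k) (hexp : IsOrderedExp expk) :
    -- every `k((G))^EL` is an ordered exponential field, and its logarithm is as constructed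
    (∀ P : PrelogField k, IsOrderedExp (PrelogField.EL.exp expk P) ∧
      ∀ a : P.EL, PrelogField.EL.log expk P (PrelogField.EL.exp expk P a) = a) ∧
    -- so is `k((x^{-1}))^LE`
    IsOrderedExp (LEField.exp expk) ∧
    -- the construction `LE(H, ψ)` applies to the logarithmic words
    Function.Bijective (shift k).EL ∧
    (∀ m, (logWords k).L (powersX k) (shift k) m ⊆ (logWords k).L (powersX k) (shift k) (m + 1)) ∧
    -- and gives the field of logarithmic-exponential series
    (∃ θ : LEField k →+* (logWords k).EL,
      IsExpEmbedding (LEField.exp expk) (PrelogField.EL.exp expk (logWords k)) θ ∧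
      Set.range θ = (logWords k).LE (powersX k) (shift k) ∧
      (∀ m, θ '' LEField.L k m = (logWords k).L (powersX k) (shift k) m) ∧
      (∀ m n, ∃ τ : OrderedGroupEmb (stage k n).Γ ((logWords k).iter n).Γ,
        τ.toAddMonoidHom.range = (logWords k).group (powersX k) (shift k) m n ∧
        ∀ f : KE k n, θ (LEField.of k m n f) = ChainUnion.of _ n (push τ f)) ∧
      (∀ c, θ (LEField.const k c) = PrelogField.EL.const (logWords k) c) ∧
      θ (LEField.x k) = PrelogField.EL.monomial (logWords k) (Word.logPow 0 1) ∧
      -- composition with `exp x` is the inverse of `ψ^EL`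
      (∀ a, (shift k).EL (θ (LEField.compExp k a)) = θ a)) ∧
    -- embedding into any EL-series field over a series field containing the logarithmic words
    (∀ (P : PrelogField k) (ι : PrelogField.Hom (logWords k) P),
      ∃ φ : LEField k →+* P.EL,
        IsExpEmbedding (LEField.exp expk) (PrelogField.EL.exp expk P) φ ∧
        (∀ c, φ (LEField.const k c) = PrelogField.EL.const P c) ∧
        φ (LEField.x k) = PrelogField.EL.monomial P (ι.toFun (Word.logPow 0 1))) ∧
    -- embedding into the EL-series field of any nonempty chain with a decreasing embedding
    (∀ (I : Type u) [LinearOrder I] (σ : I → I) (hσ : StrictMono σ), (∀ i, σ i < i) → ∀ i : I,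
      ∃ φ : LEField k →+* (hahnField k I σ hσ).EL,
        IsExpEmbedding (LEField.exp expk) (PrelogField.EL.exp expk (hahnField k I σ hσ)) φ ∧
        (∀ c, φ (LEField.const k c) = PrelogField.EL.const (hahnField k I σ hσ) c) ∧
        φ (LEField.x k) = PrelogField.EL.monomial (hahnField k I σ hσ) (HahnGroup.gen k i)) ∧
    -- the same for the transseries, which form an exponential subfield
    (∃ E : transseries expk → transseries expk, IsOrderedExp E ∧
      (∀ a, (E a : LEField k) = LEField.exp expk a) ∧
      (∀ (P : PrelogField k), Nonempty (PrelogField.Hom (logWords k) P) →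
        ∃ φ : transseries expk →+* P.EL, IsExpEmbedding E (PrelogField.EL.exp expk P) φ) ∧
      ∀ (I : Type u) [LinearOrder I] [Nonempty I] (σ : I → I) (hσ : StrictMono σ),
        (∀ i, σ i < i) → ∃ φ : transseries expk →+* (hahnField k I σ hσ).EL,
          IsExpEmbedding E (PrelogField.EL.exp expk (hahnField k I σ hσ)) φ) := by
  have hLE := (LogSystem.words k).isOrderedExp_LEField_exp hexp
  refine ⟨fun P => ⟨PrelogField.isOrderedExp_exp hexp P, PrelogField.log_exp hexp P⟩, hLE,
    PrelogField.shift_EL_bijective, LogSystem.words_L_subset,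
    ⟨(LogSystem.words k).embLE, (LogSystem.words k).isExpEmbedding_embLE hexp,
      LogSystem.range_words_embLE, LogSystem.image_words_L,
      fun m n => ⟨((LogSystem.words k).emb m n).toOrderedGroupEmb,
        LogSystem.range_words_emb m n, fun f => rfl⟩,
      (LogSystem.words k).embLE_const, (LogSystem.words k).embLE_x,
      LogSystem.shift_EL_embLE_compExp⟩, ?_, ?_, ?_⟩
  · intro P ι
    let T := (LogSystem.words k).comp ι
    exact ⟨T.embLE, T.isExpEmbedding_embLE hexp, T.embLE_const, T.embLE_x⟩
  · intro I _ σ hσ h i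
    let T := LogSystem.hahn (k := k) I σ hσ h i
    exact ⟨T.embLE, T.isExpEmbedding_embLE hexp, T.embLE_const, T.embLE_x⟩
  · refine ⟨transseriesExp expk, isOrderedExp_transseriesExp hLE, fun _ => rfl, ?_, ?_⟩
    · rintro P ⟨ι⟩
      exact ((LogSystem.words k).comp ι).exists_isExpEmbedding_transseries hexp
    · intro I _ ⟨i⟩ σ hσ h
      exact (LogSystem.hahn (k := k) I σ hσ h i).exists_isExpEmbedding_transseries hexp
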